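/- A CAT$(-1)$-space is a complete geodesic metric space all of whose geodesic triangles are thinner than their comparison triangles in the hyperbolic plane $\mathbb H^2$ (of curvature $-1$). Its boundary $\partial_\infty X$ is the set of classes of sequences converging to infinity, where $(x_n)$ converges to infinity if $(x_n|x_m)_o\to\infty$ as $n,m\to\infty$, two such sequences are equivalent if $(x_n|x_n')_o\to\infty$, and $(x|x')_o=\frac12(|ox|+|ox'|-|xx'|)$. For $o\in X$ and $y,y'\in\partial_\infty X$ let $\gamma,\gamma'$ be the unit speed geodesic rays from $o$ to $y,y'$, and let $\theta_o(y,y')$ be the limit, as $t\to\infty$, of the angle at $\bar o$ of the comparison triangle in $\mathbb H^2$ for $o,\gamma(t),\gamma'(t)$. The Bourdon metric with base point $o$ is $\rho_o(y,y')=\sin\frac12\theta_o(y,y')$. A Möbius embedding is an injective map that preserves the cross ratios $\frac{d(z_1,z_2)\,d(z_3,z_4)}{d(z_1,z_3)\,d(z_2,z_4)}$ of all quadruples of distinct points. **Theorem.** Let $(W,d)$ be a metric space with exactly four points that satisfies the Ptolemy inequality $$d(x,z)\,d(y,u)\le d(x,y)\,d(z,u)+d(y,z)\,d(u,x)\qquad\text{for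 all }x,y,z,u\in W.$$ Then there are a CAT$(-1)$-space $X$, a point $o\in X$ and a Möbius embedding $f:(W,d)\to(\partial_\infty X,\rho_o)$. Moreover, $X$, $o$ and $f$ can be chosen so that the following holds for some enumeration $W=\{w_0,w_1,w_2,w_3\}$. Put $$a=\sqrt{\frac{d(w_0,w_1)\,d(w_2,w_3)}{d(w_0,w_2)\,d(w_1,w_3)}},\qquad b=\sqrt{\frac{d(w_1,w_2)\,d(w_3,w_0)}{d(w_0,w_2)\,d(w_1,w_3)}}.$$ 1. $a\le 1$ and $b\le 1$, and the Bourdon metric at $o$ realizes the normalized metric: with $y_i=f(w_i)$, $$\rho_o(y_0,y_1)=\rho_o(y_2,y_3)=a,\quad \rho_o(y_1,y_2)=\rho_o(y_3,y_0)=b,\quad \rho_o(y_0,y_2)=\rho_o(y_1,y_3)=1.$$ 2. There are $\alpha,\beta\in(0,\pi]$ with $\sin\frac\alpha2=a$, $\sin\frac\beta2=b$ and $2(\alpha+\beta)\ge2\pi$ such that $X$ is obtained by gluing four triangles $T_0,T_1,T_2,T_3$ of $\mathbb H^2$ cyclically at the cone point $o$. Each $T_i$ has one vertex in $\mathbb H^2$,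 which is glued to $o$, and two ideal vertices; the angles at the vertex $o$ are $\alpha,\beta,\alpha,\beta$, in this order. (A triangle with angle $\pi$ is a geodesic line.) Precisely, with indices modulo $4$ and with geodesic rays $\eta_i$ from $o$ to $y_i$: each $T_i$ is isometrically embedded in $X$ with its sides issuing from $o$ equal to $\eta_i$ and $\eta_{i+1}$; $T_i\cap T_{i+1}=\eta_{i+1}$; $T_i\cap T_{i+2}=\{o\}$; and $X=T_0\cup T_1\cup T_2\cup T_3$. In particular the total angle at $o$ is $2(\alpha+\beta)\ge 2\pi$. -/

import Mathlib

open Filter Topology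

namespace PtolemyCAT

noncomputable section

/-! ### Geodesics and CAT(-1) spaces -/

/-- Every two points of `X` are joined by a geodesic segment. -/
def IsGeodesicSpace (X : Type*) [MetricSpace X] : Prop :=
  ∀ x y : X, ∃ γ : ℝ → X, γ 0 = x ∧ γ (dist x y) = y ∧
    ∀ s ∈ Set.Icc 0 (dist x y), ∀ t ∈ Set.Icc 0 (dist x y), dist (γ s) (γ t) = |s - t|

/-- Complete geodesic metric spaces whose geodesic triangles are thinner than their comparison
triangles in the hyperbolic plane (the upper half plane with its metric of curvature `-1`).
Here `p` is a point on a side from `x` to `y`, `q` is a point on a side from `x` to `z`, and the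
primed points are a comparison triangle with the comparison points of `p` and `q`. In a geodesic
space, `p` lies on some geodesic from `x` to `y` iff `dist x p + dist p y = dist x y`. -/
structure IsCATNegOne (X : Type*) [MetricSpace X] : Prop where
  complete : CompleteSpace X
  geodesic : IsGeodesicSpace X
  thin : ∀ (x y z p q : X) (x' y' z' p' q' : UpperHalfPlane),
    dist x' y' = dist x y → dist x' z' = dist x z → dist y' z' = dist y z →
    dist x p + dist p y = dist x y → dist x q + dist q z = dist x z →
    dist x' p' = dist x p → dist p' y' = dist p y →
    dist x' q' = dist x q → dist q' z' = dist q z →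
    dist p q ≤ dist p' q'

/-- `γ` restricted to `[0, ∞)` is a unit speed geodesic ray starting at `o`. -/
def IsRay {X : Type*} [MetricSpace X] (o : X) (γ : ℝ → X) : Prop :=
  γ 0 = o ∧ ∀ s t : ℝ, 0 ≤ s → 0 ≤ t → dist (γ s) (γ t) = |s - t|

/-! ### The boundary at infinity -/

/-- The Gromov product `(x | y)_o`. -/
def gromovProd {X : Type*} [MetricSpace X] (o x y : X) : ℝ :=
  (dist o x + dist o y - dist x y) / 2

/-- The sequence `x` converges to infinity. Gromov products with respect to two base points
differ by a bounded amount, so that "for all `o`" and "for some `o`" agree. -/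
def ConvergesToInfinity {X : Type*} [MetricSpace X] (x : ℕ → X) : Prop :=
  ∀ o : X, Tendsto (fun p : ℕ × ℕ => gromovProd o (x p.1) (x p.2)) atTop atTop

/-- Equivalence of sequences that converge to infinity. -/
def EquivAtInfinity {X : Type*} [MetricSpace X]
    (x x' : {x : ℕ → X // ConvergesToInfinity x}) : Prop :=
  ∀ o : X, Tendsto (fun n : ℕ => gromovProd o (x.1 n) (x'.1 n)) atTop atTop

/-- The boundary at infinity: classes of sequences converging to infinity. In a Gromov
hyperbolic space, in particular in a CAT(-1) space, `EquivAtInfinity` is an equivalence relation,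
and the quotient consists of its classes. -/
def Boundary (X : Type*) [MetricSpace X] : Type _ :=
  Quot (EquivAtInfinity (X := X))

/-- `γ` is a geodesic ray from `o` to the boundary point `y`. -/
def IsRayTo {X : Type*} [MetricSpace X] (o : X) (y : Boundary X) (γ : ℝ → X) : Prop :=
  IsRay o γ ∧ ∃ h : ConvergesToInfinity (fun n : ℕ => γ n), Quot.mk _ ⟨fun n : ℕ => γ n, h⟩ = y

/-- The geodesic ray from `o` to `y` (in a CAT(-1) space it exists and is unique on `[0, ∞)`). -/
def rayTo {X : Type*} [MetricSpace X] (o : X) (y : Boundary X) : ℝ → X :=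
  @Classical.epsilon (ℝ → X) ⟨fun _ => o⟩ (IsRayTo o y)

/-! ### The Bourdon metric -/

/-- The angle of a triangle in the hyperbolic plane between two sides of lengths `a` and `b`,
if the third side has length `c` (hyperbolic law of cosines). -/
def compAngle (a b c : ℝ) : ℝ :=
  Real.arccos ((Real.cosh a * Real.cosh b - Real.cosh c) / (Real.sinh a * Real.sinh b))

/-- The asymptotic comparison angle `θ_o(y, y')`. In a CAT(-1) space the limit exists. -/
def asymptoticAngle {X : Type*} [MetricSpace X] (o : X) (y y' : Boundary X) : ℝ :=
  limUnder atTop (fun t : ℝ => compAngle t t (dist (rayTo o y t) (rayTo o y' t)))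

/-- The Bourdon metric `ρ_o` with base point `o`. -/
def bourdon {X : Type*} [MetricSpace X] (o : X) (y y' : Boundary X) : ℝ :=
  Real.sin (asymptoticAngle o y y' / 2)

/-! ### Möbius embeddings and the Ptolemy inequality -/

/-- The cross ratio of four points with respect to a distance function. -/
def crossRatio {Z : Type*} (d : Z → Z → ℝ) (z₁ z₂ z₃ z₄ : Z) : ℝ :=
  (d z₁ z₂ * d z₃ z₄) / (d z₁ z₃ * d z₂ z₄)

/-- `f` is injective and preserves the cross ratios of quadruples of distinct points. -/
def IsMoebiusEmbedding {W Y : Type*} (d : W → W → ℝ) (ρ : Y → Y → ℝ) (f : W → Y) : Prop :=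
  Function.Injective f ∧
    ∀ w₁ w₂ w₃ w₄ : W, w₁ ≠ w₂ → w₁ ≠ w₃ → w₁ ≠ w₄ → w₂ ≠ w₃ → w₂ ≠ w₄ → w₃ ≠ w₄ →
      crossRatio ρ (f w₁) (f w₂) (f w₃) (f w₄) = crossRatio d w₁ w₂ w₃ w₄

/-- The Ptolemy inequality for all quadruples of points. -/
def IsPtolemy (W : Type*) [MetricSpace W] : Prop :=
  ∀ w₁ w₂ w₃ w₄ : W,
    dist w₁ w₃ * dist w₂ w₄ ≤ dist w₁ w₂ * dist w₃ w₄ + dist w₂ w₃ * dist w₄ w₁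

/-! ### Gluing ideal hyperbolic triangles -/

/-- A set that contains every geodesic segment between two of its points. -/
def IsGeodesicallyConvex (C : Set UpperHalfPlane) : Prop :=
  ∀ x ∈ C, ∀ y ∈ C, ∀ z, dist x z + dist z y = dist x y → z ∈ C

/-- The closed convex hull of two rays `r`, `r'` in the hyperbolic plane. If they start at the same
point `p`, this is the triangle with vertex `p` and two ideal vertices, the endpoints of the rays
(it degenerates to a geodesic line if the angle at `p` is `π`). -/
def idealTriangle (r r' : ℝ → UpperHalfPlane) : Set UpperHalfPlane :=
  ⋂₀ {C | r '' Set.Ici 0 ⊆ C ∧ r' '' Set.Ici 0 ⊆ C ∧ IsClosed C ∧ IsGeodesicallyConvex C}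

/-- `X` is glued cyclically from four hyperbolic triangles `T 0, …, T 3` with one vertex `o` in `X`
and two ideal vertices each: `T i` has angle `θ i` at `o`, its sides issuing from `o` are the rays
`η i` and `η (i + 1)`, it meets `T (i + 1)` exactly in `η (i + 1)` and `T (i + 2)` exactly in `o`,
and the four triangles cover `X`. (Indices are modulo 4. If `X` is a geodesic space, then this
determines its metric: it is the quotient metric of the gluing.) -/
def IsCyclicGluing {X : Type*} [MetricSpace X] (o : X) (η : Fin 4 → ℝ → X) (θ : Fin 4 → ℝ) :
    Prop :=
  ∃ (p : Fin 4 → UpperHalfPlane) (r r' : Fin 4 → ℝ → UpperHalfPlane)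
    (g : Fin 4 → UpperHalfPlane → X),
    (∀ i, IsRay (p i) (r i) ∧ IsRay (p i) (r' i)) ∧
    (∀ i, ∀ t : ℝ, 0 < t → compAngle t t (dist (r i t) (r' i t)) = θ i) ∧
    (∀ i, ∀ x ∈ idealTriangle (r i) (r' i), ∀ y ∈ idealTriangle (r i) (r' i),
      dist (g i x) (g i y) = dist x y) ∧
    (∀ i, g i (p i) = o) ∧
    (∀ i, ∀ t : ℝ, 0 ≤ t → g i (r i t) = η i t ∧ g i (r' i t) = η (i + 1) t) ∧
    (∀ i, g i '' idealTriangle (r i) (r' i) ∩ g (i + 1) '' idealTriangle (r (i + 1)) (r' (i + 1))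
      = η (i + 1) '' Set.Ici 0) ∧
    (∀ i, g i '' idealTriangle (r i) (r' i) ∩ g (i + 2) '' idealTriangle (r (i + 2)) (r' (i + 2))
      = {o}) ∧
    (⋃ i, g i '' idealTriangle (r i) (r' i)) = Set.univ

end

end PtolemyCAT

open PtolemyCAT

namespace PtolemyCAT

noncomputable section

open UpperHalfPlane

/-! ### Hyperboloid coordinates on the upper half plane -/

/-! Label the points so that the diagonal product `d(w₀,w₂) d(w₁,w₃)` is the largest of the three
products over perfect matchings. Then a, b ≤ 1, and dividing the Ptolemy inequality by the diagonal
product gives a² + b² ≥ 1. For α = 2 arcsin a and β = 2 arcsin b this means α + β ≥ π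
(`pi_le_two_arcsin_add`). Glue four ideal triangles with angles α, β, α, β around a point o.
Consecutive rays make the angles α or β at o, opposite rays make an angle α + β ≥ π, which counts as
π; so the Bourdon metric takes the values a, b and 1. Its three matching products are those of d
divided by one constant, and cross ratios depend only on ratios of matching products.

The glued space is realized inside the hyperbolic cone over a circle of length L = 2(α + β) ≥ 2π,
where distances obey the hyperbolic law of cosines with the angle truncated at π. Curvature is
controlled by Stewart's theorem: in the plane cosh of the distance to x satisfies an identity along
a segment (`hyperbolic_stewart`), and a space in which the corresponding inequality holds is CAT(-1)
(`HasHyperbolicConvexity.isCATNegOne`). For the cone the inequality follows by unfolding x into the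
plane so that the distance to the point on the segment is kept and the distances to the ends do not
grow; this uses L ≥ 2π (`HypCone.exists_comparison`). The union of the triangles inherits it because
it is convex in the cone (`CyclicSectors.Covers.of_between`, `CyclicSectors.Covers.of_ang_eq`).

At infinity, a large Gromov product forces a small angle at o (`HypCone.one_sub_cos_angle_le`). So a
boundary point determines a direction, the ray to each ideal vertex is unique, and the Bourdon
metric can be computed. -/

/-- The time coordinate of the point of the hyperboloid with space coordinates `ζ`. -/
def hypTime (ζ : ℂ) : ℝ := √(1 + ζ.re ^ 2 + ζ.im ^ 2)

lemma hypTime_sq (ζ : ℂ) : hypTime ζ ^ 2 = 1 + ζ.re ^ 2 + ζ.im ^ 2 :=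
  Real.sq_sqrt (by positivity)

lemma hypTime_pos (ζ : ℂ) : 0 < hypTime ζ := Real.sqrt_pos.2 (by positivity)

lemma re_lt_hypTime (ζ : ℂ) : ζ.re < hypTime ζ :=
  lt_of_pow_lt_pow_left₀ 2 (hypTime_pos ζ).le (by rw [hypTime_sq]; nlinarith [sq_nonneg ζ.im])

lemma hypTime_eq {ζ : ℂ} {a : ℝ} (ha : 0 ≤ a) (h : a ^ 2 = 1 + ζ.re ^ 2 + ζ.im ^ 2) :
    hypTime ζ = a := by
  rw [hypTime, ← h, Real.sqrt_sq ha]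

/-- The space coordinates of a point of the upper half plane in the hyperboloid model. -/
def hypCoord (z : ℍ) : ℂ := ⟨(z.re ^ 2 + z.im ^ 2 - 1) / (2 * z.im), z.re / z.im⟩

/-- The point of the upper half plane with given space coordinates in the hyperboloid model. -/
def ofHypCoord (ζ : ℂ) : ℍ :=
  ⟨⟨ζ.im / (hypTime ζ - ζ.re), 1 / (hypTime ζ - ζ.re)⟩,
    one_div_pos.2 (sub_pos.2 (re_lt_hypTime ζ))⟩

lemma hypTime_hypCoord (z : ℍ) :
    hypTime (hypCoord z) = (z.re ^ 2 + z.im ^ 2 + 1) / (2 * z.im) := by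
  have := z.im_pos
  refine hypTime_eq (by positivity) ?_
  simp only [hypCoord]
  field_simp
  ring

lemma hypCoord_ofHypCoord (ζ : ℂ) : hypCoord (ofHypCoord ζ) = ζ := by
  have hk : 0 < hypTime ζ - ζ.re := sub_pos.2 (re_lt_hypTime ζ)
  have h1 : (ofHypCoord ζ).re = ζ.im / (hypTime ζ - ζ.re) := rfl
  have h2 : (ofHypCoord ζ).im = 1 / (hypTime ζ - ζ.re) := rfl
  have h3 := hypTime_sq ζ
  apply Complex.ext
  · simp only [hypCoord, h1, h2]
    field_simp
    linear_combination (-1 : ℝ) * h3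
  · simp only [hypCoord, h1, h2]
    field_simp

lemma ofHypCoord_hypCoord (z : ℍ) : ofHypCoord (hypCoord z) = z := by
  have hz := z.im_pos
  have hk : hypTime (hypCoord z) - (hypCoord z).re = 1 / z.im := by
    rw [hypTime_hypCoord]
    simp only [hypCoord]
    field_simp
    ring
  apply UpperHalfPlane.ext
  apply Complex.ext
  · change (hypCoord z).im / (hypTime (hypCoord z) - (hypCoord z).re) = z.re
    rw [hk]
    simp only [hypCoord]
    field_simp
  · change 1 / (hypTime (hypCoord z) - (hypCoord z).re) = z.im
    rw [hk]
    field_simp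

lemma hypCoord_injective : Function.Injective hypCoord :=
  Function.LeftInverse.injective ofHypCoord_hypCoord

lemma continuous_hypCoord : Continuous hypCoord := by
  have h : hypCoord = fun z : ℍ =>
      (((z.re ^ 2 + z.im ^ 2 - 1) / (2 * z.im) : ℝ) : ℂ) + ((z.re / z.im : ℝ) : ℂ) * Complex.I := by
    funext z
    exact Complex.mk_eq_add_mul_I _ _
  have hre : Continuous fun z : ℍ => z.re := UpperHalfPlane.continuous_re
  have him : Continuous fun z : ℍ => z.im := UpperHalfPlane.continuous_im
  rw [h]
  refine (Complex.continuous_ofReal.comp ?_).add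
    ((Complex.continuous_ofReal.comp ?_).mul continuous_const)
  · exact (((hre.pow 2).add (him.pow 2)).sub continuous_const).div (continuous_const.mul him)
      fun z => (mul_pos two_pos z.im_pos).ne'
  · exact hre.div him fun z => z.im_pos.ne'

/-- This is the Minkowski product up to sign. In these coordinates distances are bilinear and
segments linear, so metric identities reduce to algebra. -/
lemma cosh_dist_eq (z w : ℍ) :
    Real.cosh (dist z w) = hypTime (hypCoord z) * hypTime (hypCoord w)
      - ((hypCoord z).re * (hypCoord w).re + (hypCoord z).im * (hypCoord w).im) := by
  have hz := z.im_pos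
  have hw := w.im_pos
  rw [UpperHalfPlane.cosh_dist, hypTime_hypCoord, hypTime_hypCoord, Complex.dist_eq_re_im,
    Real.sq_sqrt (by positivity)]
  simp only [hypCoord, UpperHalfPlane.coe_re, UpperHalfPlane.coe_im]
  field_simp
  ring

/-- A lightlike vector orthogonal to a timelike one vanishes, by Cauchy-Schwarz in the space
coordinates. -/
lemma isotropic_orthogonal_eq_zero {v₀ v₁ v₂ t p₁ p₂ : ℝ} (ht : t ^ 2 = 1 + p₁ ^ 2 + p₂ ^ 2)
    (hv : v₀ ^ 2 = v₁ ^ 2 + v₂ ^ 2) (h : v₀ * t = v₁ * p₁ + v₂ * p₂) :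
    v₀ = 0 ∧ v₁ = 0 ∧ v₂ = 0 := by
  have h1 : v₀ ^ 2 * t ^ 2 = (v₁ * p₁ + v₂ * p₂) ^ 2 := by rw [← h]; ring
  have h2 : v₀ ^ 2 ≤ 0 := by
    rw [ht] at h1
    nlinarith [sq_nonneg (v₁ * p₂ - v₂ * p₁)]
  have h0 : v₀ = 0 := by
    have : v₀ ^ 2 = 0 := le_antisymm h2 (sq_nonneg _)
    exact pow_eq_zero_iff two_ne_zero |>.1 this
  refine ⟨h0, ?_, ?_⟩ <;> nlinarith [sq_nonneg v₁, sq_nonneg v₂]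

/-- A point between `y` and `z` is a combination of `y` and `z` in the hyperboloid model. -/
lemma hypCoord_of_between {y p z : ℍ} (h : dist y p + dist p z = dist y z) :
    Real.sinh (dist y z) * hypTime (hypCoord p) =
        Real.sinh (dist p z) * hypTime (hypCoord y) + Real.sinh (dist y p) * hypTime (hypCoord z) ∧
      (Real.sinh (dist y z) : ℂ) * hypCoord p =
        Real.sinh (dist p z) * hypCoord y + Real.sinh (dist y p) * hypCoord z := by
  have hyp := cosh_dist_eq y p
  have hpz := cosh_dist_eq p z
  have hyz := cosh_dist_eq y z
  have hy := hypTime_sq (hypCoord y)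
  have hp := hypTime_sq (hypCoord p)
  have hz := hypTime_sq (hypCoord z)
  rw [← h] at hyz ⊢
  set s := dist y p
  set t := dist p z
  have es := Real.cosh_sq s
  have et := Real.cosh_sq t
  rw [Real.cosh_add] at hyz
  rw [Real.sinh_add]
  generalize hypTime (hypCoord y) = ty at *
  generalize hypTime (hypCoord p) = tp at *
  generalize hypTime (hypCoord z) = tz at *
  generalize (hypCoord y) = Y at *
  generalize (hypCoord p) = P at *
  generalize (hypCoord z) = Z at *
  generalize Real.sinh s = S at *
  generalize Real.sinh t = T at *
  generalize Real.cosh s = C at *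
  generalize Real.cosh t = D at *
  -- The defect of the claimed linear relation is lightlike and orthogonal to `p`.
  have key := isotropic_orthogonal_eq_zero (v₀ := (S * D + C * T) * tp - T * ty - S * tz)
    (v₁ := (S * D + C * T) * P.re - T * Y.re - S * Z.re)
    (v₂ := (S * D + C * T) * P.im - T * Y.im - S * Z.im) (t := tp) (p₁ := P.re) (p₂ := P.im)
    hp (by
      linear_combination (S * D + C * T) ^ 2 * hp + T ^ 2 * hy + S ^ 2 * hz
        + 2 * (S * D + C * T) * T * hyp + 2 * (S * D + C * T) * S * hpz
        - 2 * T * S * hyz - T ^ 2 * es - S ^ 2 * et)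
    (by linear_combination (S * D + C * T) * hp + T * hyp + S * hpz)
  refine ⟨by linarith [key.1], Complex.ext ?_ ?_⟩
  · simp only [Complex.add_re, Complex.re_ofReal_mul]
    linarith [key.2.1]
  · simp only [Complex.add_im, Complex.im_ofReal_mul]
    linarith [key.2.2]

/-- Stewart's theorem in the hyperbolic plane. -/
lemma hyperbolic_stewart {y p z : ℍ} (h : dist y p + dist p z = dist y z) (x : ℍ) :
    Real.cosh (dist x p) * Real.sinh (dist y z) =
      Real.cosh (dist x y) * Real.sinh (dist p z) +
        Real.cosh (dist x z) * Real.sinh (dist y p) := by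
  obtain ⟨h1, h2⟩ := hypCoord_of_between h
  have h3 := congrArg Complex.re h2
  have h4 := congrArg Complex.im h2
  simp only [Complex.add_re, Complex.add_im, Complex.re_ofReal_mul, Complex.im_ofReal_mul] at h3 h4
  rw [cosh_dist_eq x p, cosh_dist_eq x y, cosh_dist_eq x z]
  linear_combination hypTime (hypCoord x) * h1 - (hypCoord x).re * h3 - (hypCoord x).im * h4

/-- Nonnegative combinations in the hyperboloid model lie on the geodesic segment. -/
lemma exists_between_comb (y z : ℍ) {l m : ℝ} (hl : 0 ≤ l) (hm : 0 ≤ m) (hlm : 0 < l + m) :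
    ∃ (p : ℍ) (N : ℝ), 0 < N ∧ N ^ 2 = l ^ 2 + m ^ 2 + 2 * l * m * Real.cosh (dist y z) ∧
      (N : ℂ) * hypCoord p = l * hypCoord y + m * hypCoord z ∧
      dist y p + dist p z = dist y z ∧ N * Real.sinh (dist y p) = m * Real.sinh (dist y z) := by
  set c := Real.cosh (dist y z) with hc
  have hc1 : 1 ≤ c := Real.one_le_cosh _
  have hN0 : 0 < l ^ 2 + m ^ 2 + 2 * l * m * c := by
    nlinarith [mul_nonneg hl hm, mul_pos hlm hlm, mul_nonneg (mul_nonneg hl hm) (sub_nonneg.2 hc1)]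
  obtain ⟨N, hN, hN2⟩ : ∃ N : ℝ, 0 < N ∧ N ^ 2 = l ^ 2 + m ^ 2 + 2 * l * m * c :=
    ⟨_, Real.sqrt_pos.2 hN0, Real.sq_sqrt hN0.le⟩
  set ζ : ℂ := (l * hypCoord y + m * hypCoord z) / N with hζ
  have hNζ : (N : ℂ) * ζ = l * hypCoord y + m * hypCoord z := by
    rw [hζ]; field_simp [Complex.ofReal_ne_zero.2 hN.ne']
  have hre : N * ζ.re = l * (hypCoord y).re + m * (hypCoord z).re := by
    simpa using congrArg Complex.re hNζ
  have him : N * ζ.im = l * (hypCoord y).im + m * (hypCoord z).im := by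
    simpa using congrArg Complex.im hNζ
  have hyz := cosh_dist_eq y z
  rw [← hc] at hyz
  have hty := hypTime_sq (hypCoord y)
  have htz := hypTime_sq (hypCoord z)
  have htime : N * hypTime ζ = l * hypTime (hypCoord y) + m * hypTime (hypCoord z) := by
    have h0 : 0 ≤ l * hypTime (hypCoord y) + m * hypTime (hypCoord z) :=
      add_nonneg (mul_nonneg hl (hypTime_pos _).le) (mul_nonneg hm (hypTime_pos _).le)
    refine (sq_eq_sq₀ (mul_nonneg hN.le (hypTime_pos _).le) h0).1 ?_
    have e1 : (N * hypTime ζ) ^ 2 = N ^ 2 + (N * ζ.re) ^ 2 + (N * ζ.im) ^ 2 := by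
      rw [mul_pow, hypTime_sq]; ring
    rw [e1, hre, him, hN2]
    linear_combination (-l ^ 2) * hty - m ^ 2 * htz + 2 * l * m * hyz
  have hp : hypCoord (ofHypCoord ζ) = ζ := hypCoord_ofHypCoord ζ
  have hcy : N * Real.cosh (dist y (ofHypCoord ζ)) = l + m * c := by
    rw [cosh_dist_eq, hp]
    linear_combination hypTime (hypCoord y) * htime - (hypCoord y).re * hre
      - (hypCoord y).im * him + l * hty - m * hyz
  have hcz : N * Real.cosh (dist (ofHypCoord ζ) z) = l * c + m := by
    rw [cosh_dist_eq, hp]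
    linear_combination hypTime (hypCoord z) * htime - (hypCoord z).re * hre
      - (hypCoord z).im * him + m * htz - l * hyz
  have hs : 0 ≤ Real.sinh (dist y z) := Real.sinh_nonneg_iff.2 dist_nonneg
  have hs2 : Real.sinh (dist y z) ^ 2 = c ^ 2 - 1 := by rw [hc, Real.cosh_sq]; ring
  have hsy : N * Real.sinh (dist y (ofHypCoord ζ)) = m * Real.sinh (dist y z) := by
    refine (sq_eq_sq₀ (mul_nonneg hN.le (Real.sinh_nonneg_iff.2 dist_nonneg))
      (mul_nonneg hm hs)).1 ?_
    rw [mul_pow, mul_pow, hs2, Real.sinh_sq, mul_sub, ← mul_pow, hcy, hN2]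
    ring
  have hsz : N * Real.sinh (dist (ofHypCoord ζ) z) = l * Real.sinh (dist y z) := by
    refine (sq_eq_sq₀ (mul_nonneg hN.le (Real.sinh_nonneg_iff.2 dist_nonneg))
      (mul_nonneg hl hs)).1 ?_
    rw [mul_pow, mul_pow, hs2, Real.sinh_sq, mul_sub, ← mul_pow, hcz, hN2]
    ring
  refine ⟨ofHypCoord ζ, N, hN, hN2, by rw [hp, hNζ], ?_, hsy⟩
  have hcosh : Real.cosh (dist y (ofHypCoord ζ) + dist (ofHypCoord ζ) z) = c := by
    have : N ^ 2 * Real.cosh (dist y (ofHypCoord ζ) + dist (ofHypCoord ζ) z) = N ^ 2 * c := by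
      rw [Real.cosh_add]
      calc _ = (N * Real.cosh (dist y (ofHypCoord ζ))) * (N * Real.cosh (dist (ofHypCoord ζ) z))
            + (N * Real.sinh (dist y (ofHypCoord ζ))) *
              (N * Real.sinh (dist (ofHypCoord ζ) z)) := by
              ring
        _ = _ := by
          rw [hcy, hcz, hsy, hsz, hN2]
          linear_combination l * m * hs2
    exact mul_left_cancel₀ (pow_pos hN 2).ne' this
  have h1 := Real.cosh_le_cosh.1 hcosh.le
  have h2 := Real.cosh_le_cosh.1 hcosh.ge
  rw [abs_of_nonneg dist_nonneg, abs_of_nonneg (by positivity)] at h1 h2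
  exact le_antisymm h1 h2

/-- The upper half plane is a geodesic space. -/
lemma exists_dist_eq (y z : ℍ) {s : ℝ} (hs0 : 0 ≤ s) (hs : s ≤ dist y z) :
    ∃ p : ℍ, dist y p = s ∧ dist p z = dist y z - s := by
  rcases hs.eq_or_lt with rfl | hlt
  · exact ⟨z, rfl, by simp⟩
  set d := dist y z with hd
  have hdpos : 0 < d := hs0.trans_lt hlt
  have hm : 0 ≤ Real.sinh s := Real.sinh_nonneg_iff.2 hs0
  have hl : 0 < Real.sinh (d - s) := Real.sinh_pos_iff.2 (by linarith)
  have hsd : 0 < Real.sinh d := Real.sinh_pos_iff.2 hdpos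
  -- With the weights sinh (d - s) and sinh s the normalizing factor N is sinh d, which puts `p` at
  -- distance s from `y`.
  obtain ⟨p, N, hN, hN2, -, hb, hsp⟩ := exists_between_comb y z hl.le hm (by linarith)
  have hNd : N = Real.sinh d := by
    refine (sq_eq_sq₀ hN.le hsd.le).1 ?_
    rw [hN2, ← hd, Real.sinh_sub]
    linear_combination (-Real.sinh s ^ 2) * Real.cosh_sq d + Real.sinh d ^ 2 * Real.cosh_sq s
  have : Real.sinh (dist y p) = Real.sinh s := by
    rw [← hd, hNd, mul_comm] at hsp
    exact mul_right_cancel₀ hsd.ne' hsp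
  have h2 := Real.sinh_injective this
  exact ⟨p, h2, by linarith⟩

/-! ### Polar coordinates in the hyperbolic plane -/

/-- The point of the hyperbolic plane with polar coordinates `r`, `φ`. -/
def polar (r φ : ℝ) : ℍ := ofHypCoord ⟨Real.sinh r * Real.cos φ, Real.sinh r * Real.sin φ⟩

lemma hypCoord_polar (r φ : ℝ) :
    hypCoord (polar r φ) = ⟨Real.sinh r * Real.cos φ, Real.sinh r * Real.sin φ⟩ :=
  hypCoord_ofHypCoord _

lemma hypTime_polar (r φ : ℝ) : hypTime (hypCoord (polar r φ)) = Real.cosh r := by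
  rw [hypCoord_polar]
  refine hypTime_eq (Real.cosh_pos r).le ?_
  simp only
  linear_combination Real.cosh_sq r - Real.sinh r ^ 2 * Real.sin_sq_add_cos_sq φ

lemma cosh_dist_polar (r φ s ψ : ℝ) : Real.cosh (dist (polar r φ) (polar s ψ)) =
    Real.cosh r * Real.cosh s - Real.sinh r * Real.sinh s * Real.cos (φ - ψ) := by
  rw [cosh_dist_eq, hypTime_polar, hypTime_polar, hypCoord_polar, hypCoord_polar, Real.cos_sub]
  ring

lemma le_of_cosh_le {a b : ℝ} (ha : 0 ≤ a) (hb : 0 ≤ b) (h : Real.cosh a ≤ Real.cosh b) :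
    a ≤ b := by
  have := Real.cosh_le_cosh.1 h
  rwa [abs_of_nonneg ha, abs_of_nonneg hb] at this

lemma eq_of_cosh_eq {a b : ℝ} (ha : 0 ≤ a) (hb : 0 ≤ b) (h : Real.cosh a = Real.cosh b) :
    a = b :=
  le_antisymm (le_of_cosh_le ha hb h.le) (le_of_cosh_le hb ha h.ge)

lemma dist_polar_le {r s φ ψ φ' ψ' : ℝ} (hr : 0 ≤ r) (hs : 0 ≤ s)
    (h : Real.cos (φ' - ψ') ≤ Real.cos (φ - ψ)) :
    dist (polar r φ) (polar s ψ) ≤ dist (polar r φ') (polar s ψ') := by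
  refine le_of_cosh_le dist_nonneg dist_nonneg ?_
  rw [cosh_dist_polar, cosh_dist_polar]
  have := mul_nonneg (Real.sinh_nonneg_iff.2 hr) (Real.sinh_nonneg_iff.2 hs)
  nlinarith

lemma dist_polar_congr {r s φ ψ φ' ψ' : ℝ} (h : Real.cos (φ - ψ) = Real.cos (φ' - ψ')) :
    dist (polar r φ) (polar s ψ) = dist (polar r φ') (polar s ψ') := by
  refine eq_of_cosh_eq dist_nonneg dist_nonneg ?_
  rw [cosh_dist_polar, cosh_dist_polar, h]

lemma dist_polar_same (r s φ : ℝ) : dist (polar r φ) (polar s φ) = |r - s| := by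
  refine eq_of_cosh_eq dist_nonneg (abs_nonneg _) ?_
  rw [cosh_dist_polar, Real.cosh_abs, Real.cosh_sub, sub_self, Real.cos_zero, mul_one]

lemma dist_polar_opposite {r s : ℝ} (hr : 0 ≤ r) (hs : 0 ≤ s) (φ : ℝ) :
    dist (polar r φ) (polar s (φ + Real.pi)) = r + s := by
  refine eq_of_cosh_eq dist_nonneg (add_nonneg hr hs) ?_
  rw [cosh_dist_polar, Real.cosh_add, show φ - (φ + Real.pi) = -Real.pi by ring, Real.cos_neg,
    Real.cos_pi]
  ring

lemma polar_zero (φ ψ : ℝ) : polar 0 φ = polar 0 ψ := by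
  simp [polar]

lemma dist_polar_zero {r : ℝ} (hr : 0 ≤ r) (φ ψ : ℝ) : dist (polar 0 ψ) (polar r φ) = r := by
  rw [polar_zero ψ φ, dist_polar_same, zero_sub, abs_neg, abs_of_nonneg hr]

lemma isRay_polar (φ : ℝ) : IsRay (polar 0 0) (fun t => polar t φ) :=
  ⟨polar_zero _ _, fun s t _ _ => dist_polar_same s t φ⟩

/-- The radial coordinate of a point of the hyperbolic plane. -/
def polarRad (z : ℍ) : ℝ := Real.arsinh ‖hypCoord z‖

/-- The angular coordinate of a point of the hyperbolic plane. -/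
def polarArg (z : ℍ) : ℝ := (hypCoord z).arg

lemma polarRad_nonneg (z : ℍ) : 0 ≤ polarRad z := Real.arsinh_nonneg_iff.2 (norm_nonneg _)

lemma polar_polarRad_polarArg (z : ℍ) : polar (polarRad z) (polarArg z) = z := by
  rw [polar, polarRad, polarArg, Real.sinh_arsinh, Complex.norm_mul_cos_arg,
    Complex.norm_mul_sin_arg]
  exact ofHypCoord_hypCoord z

lemma polarRad_polar {r : ℝ} (hr : 0 ≤ r) (φ : ℝ) : polarRad (polar r φ) = r := by
  rw [← dist_polar_zero (polarRad_nonneg (polar r φ)) (polarArg (polar r φ)) 0,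
    polar_polarRad_polarArg, dist_polar_zero hr]

lemma polarArg_polar {r φ : ℝ} (hr : 0 < r) (h0 : 0 ≤ φ) (hpi : φ ≤ Real.pi) :
    polarArg (polar r φ) = φ := by
  have hs : 0 < Real.sinh r := Real.sinh_pos_iff.2 hr
  have : (⟨Real.sinh r * Real.cos φ, Real.sinh r * Real.sin φ⟩ : ℂ) =
      (Real.sinh r : ℂ) * (Complex.cos φ + Complex.sin φ * Complex.I) := by
    apply Complex.ext
    · simp only [Complex.re_ofReal_mul]
      simp [← Complex.ofReal_cos, ← Complex.ofReal_sin]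
    · simp only [Complex.im_ofReal_mul]
      simp [← Complex.ofReal_cos, ← Complex.ofReal_sin]
  rw [polarArg, hypCoord_polar, this,
    Complex.arg_mul_cos_add_sin_mul_I hs ⟨by linarith [Real.pi_pos], hpi⟩]

/-! ### Sectors and ideal triangles -/

lemma isClosed_halfPlane (a b : ℝ) :
    IsClosed {z : ℍ | 0 ≤ a * (hypCoord z).re + b * (hypCoord z).im} :=
  isClosed_le continuous_const
    ((continuous_const.mul (Complex.continuous_re.comp continuous_hypCoord)).add
      (continuous_const.mul (Complex.continuous_im.comp continuous_hypCoord)))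

/-- A point between two others has space coordinates proportional to a nonnegative combination of
theirs, so a linear inequality persists. -/
lemma isGeodesicallyConvex_halfPlane (a b : ℝ) :
    IsGeodesicallyConvex {z : ℍ | 0 ≤ a * (hypCoord z).re + b * (hypCoord z).im} := by
  intro x hx y hy z h
  simp only [Set.mem_ofPred_eq] at hx hy ⊢
  rcases (dist_nonneg (x := x) (y := y)).eq_or_lt with h0 | h0
  · have hxz : dist x z = 0 := by
      linarith [dist_nonneg (x := x) (y := z), dist_nonneg (x := z) (y := y)]
    rwa [← dist_eq_zero.1 hxz]
  · have h2 := (hypCoord_of_between h).2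
    have h3 := congrArg Complex.re h2
    have h4 := congrArg Complex.im h2
    simp only [Complex.add_re, Complex.add_im, Complex.re_ofReal_mul, Complex.im_ofReal_mul]
      at h3 h4
    refine nonneg_of_mul_nonneg_right (a := Real.sinh (dist x y)) ?_ (Real.sinh_pos_iff.2 h0)
    have e : Real.sinh (dist x y) * (a * (hypCoord z).re + b * (hypCoord z).im) =
        Real.sinh (dist z y) * (a * (hypCoord x).re + b * (hypCoord x).im) +
        Real.sinh (dist x z) * (a * (hypCoord y).re + b * (hypCoord y).im) := by
      linear_combination a * h3 + b * h4
    rw [e]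
    exact add_nonneg (mul_nonneg (Real.sinh_nonneg_iff.2 dist_nonneg) hx)
      (mul_nonneg (Real.sinh_nonneg_iff.2 dist_nonneg) hy)

lemma idealTriangle_subset {r r' : ℝ → ℍ} {C : Set ℍ} (h : r '' Set.Ici 0 ⊆ C)
    (h' : r' '' Set.Ici 0 ⊆ C) (hc : IsClosed C) (hg : IsGeodesicallyConvex C) :
    idealTriangle r r' ⊆ C :=
  Set.sInter_subset_of_mem ⟨h, h', hc, hg⟩

lemma isClosed_idealTriangle (r r' : ℝ → ℍ) : IsClosed (idealTriangle r r') :=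
  isClosed_sInter fun _ hC => hC.2.2.1

lemma isGeodesicallyConvex_idealTriangle (r r' : ℝ → ℍ) :
    IsGeodesicallyConvex (idealTriangle r r') :=
  fun x hx y hy z h C hC => hC.2.2.2 x (hx C hC) y (hy C hC) z h

lemma left_mem_idealTriangle (r r' : ℝ → ℍ) {t : ℝ} (ht : 0 ≤ t) : r t ∈ idealTriangle r r' :=
  fun _ hC => hC.1 ⟨t, ht, rfl⟩

lemma right_mem_idealTriangle (r r' : ℝ → ℍ) {t : ℝ} (ht : 0 ≤ t) : r' t ∈ idealTriangle r r' :=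
  fun _ hC => hC.2.1 ⟨t, ht, rfl⟩

lemma arg_mem_Icc {ζ : ℂ} {θ : ℝ} (hθ : 0 < θ) (h1 : 0 ≤ ζ.im)
    (h2 : 0 ≤ ζ.re * Real.sin θ - ζ.im * Real.cos θ) : ζ.arg ∈ Set.Icc 0 θ := by
  have h0 := Complex.arg_nonneg_iff.2 h1
  refine ⟨h0, ?_⟩
  by_contra! hlt
  have hpi := Complex.arg_le_pi ζ
  have hs : 0 < Real.sin (ζ.arg - θ) := Real.sin_pos_of_pos_of_lt_pi (by linarith) (by linarith)
  rw [Real.sin_sub] at hs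
  have hn : 0 < ‖ζ‖ := norm_pos_iff.2 (by rintro rfl; simp at hlt; linarith)
  have := mul_pos hn hs
  rw [← Complex.norm_mul_cos_arg ζ, ← Complex.norm_mul_sin_arg ζ] at h2
  nlinarith

/-- The triangle with one ordinary vertex of angle `θ` and two ideal vertices. -/
def sectorTriangle (θ : ℝ) : Set ℍ := idealTriangle (fun t => polar t 0) (fun t => polar t θ)

/-- The sector is cut out by two closed convex half planes through the vertex, each containing both
rays. -/
lemma polarArg_mem_of_mem_sectorTriangle {θ : ℝ} (hθ : 0 < θ) (hpi : θ ≤ Real.pi) {z : ℍ}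
    (hz : z ∈ sectorTriangle θ) : polarArg z ∈ Set.Icc 0 θ := by
  have hsin := Real.sin_nonneg_of_nonneg_of_le_pi hθ.le hpi
  have h1 : z ∈ {z : ℍ | 0 ≤ 0 * (hypCoord z).re + 1 * (hypCoord z).im} := by
    refine idealTriangle_subset ?_ ?_ (isClosed_halfPlane _ _)
      (isGeodesicallyConvex_halfPlane _ _) hz
    · rintro _ ⟨t, ht, rfl⟩
      simp [hypCoord_polar]
    · rintro _ ⟨t, ht, rfl⟩
      simpa [hypCoord_polar] using mul_nonneg (Real.sinh_nonneg_iff.2 ht) hsin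
  have h2 : z ∈ {z : ℍ |
      0 ≤ Real.sin θ * (hypCoord z).re + (-Real.cos θ) * (hypCoord z).im} := by
    refine idealTriangle_subset ?_ ?_ (isClosed_halfPlane _ _)
      (isGeodesicallyConvex_halfPlane _ _) hz
    · rintro _ ⟨t, ht, rfl⟩
      simpa [hypCoord_polar] using mul_nonneg hsin (Real.sinh_nonneg_iff.2 ht)
    · rintro _ ⟨t, ht, rfl⟩
      simp only [hypCoord_polar, Set.mem_ofPred_eq]
      exact le_of_eq (by ring)
  simp only [Set.mem_ofPred_eq] at h1 h2
  exact arg_mem_Icc hθ (by linarith) (by linarith)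

/-- Rotating by -u brings the combination into the range where `Complex.arg` has no jump. -/
lemma polar_shift_comb {A B u v : ℝ} (hA : 0 ≤ A) (hB : 0 ≤ B) (huv : u ≤ v)
    (hpi : v < u + Real.pi) : ∃ R w : ℝ, 0 ≤ R ∧ u ≤ w ∧ w ≤ v ∧
      A * Real.cos u + B * Real.cos v = R * Real.cos w ∧
      A * Real.sin u + B * Real.sin v = R * Real.sin w := by
  rcases huv.eq_or_lt with rfl | hlt
  · exact ⟨A + B, u, add_nonneg hA hB, le_rfl, le_rfl, by ring, by ring⟩
  set ζ : ℂ := ⟨A + B * Real.cos (v - u), B * Real.sin (v - u)⟩ with hζ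
  have hs : 0 ≤ Real.sin (v - u) := Real.sin_nonneg_of_nonneg_of_le_pi (by linarith) (by linarith)
  have harg : ζ.arg ∈ Set.Icc 0 (v - u) := by
    refine arg_mem_Icc (by linarith) (mul_nonneg hB hs) ?_
    simp only [hζ]
    nlinarith [mul_nonneg hA hs]
  have e1 : ‖ζ‖ * Real.cos ζ.arg = A + B * Real.cos (v - u) := Complex.norm_mul_cos_arg ζ
  have e2 : ‖ζ‖ * Real.sin ζ.arg = B * Real.sin (v - u) := Complex.norm_mul_sin_arg ζ
  refine ⟨‖ζ‖, u + ζ.arg, norm_nonneg _, by linarith [harg.1], by linarith [harg.2], ?_, ?_⟩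
  · rw [Real.cos_add, show v = u + (v - u) by ring, Real.cos_add]
    linear_combination (-Real.cos u) * e1 + Real.sin u * e2
  · rw [Real.sin_add, show v = u + (v - u) by ring, Real.sin_add]
    linear_combination (-Real.sin u) * e1 - Real.cos u * e2

lemma exists_polar_of_hypCoord {p : ℍ} {N R w : ℝ} (hN : 0 < N) (hR : 0 ≤ R)
    (hre : N * (hypCoord p).re = R * Real.cos w) (him : N * (hypCoord p).im = R * Real.sin w) :
    ∃ ρ : ℝ, 0 ≤ ρ ∧ p = polar ρ w := by
  refine ⟨Real.arsinh (R / N), Real.arsinh_nonneg_iff.2 (by positivity), ?_⟩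
  apply hypCoord_injective
  rw [hypCoord_polar, Real.sinh_arsinh]
  apply Complex.ext
  · simp only
    field_simp
    linarith
  · simp only
    field_simp
    linarith

lemma exists_polar_of_between {r s u v : ℝ} (hr : 0 ≤ r) (hs : 0 ≤ s) (huv : u ≤ v)
    (hpi : v < u + Real.pi) {p : ℍ}
    (h : dist (polar r u) p + dist p (polar s v) = dist (polar r u) (polar s v)) :
    ∃ ρ w : ℝ, 0 ≤ ρ ∧ u ≤ w ∧ w ≤ v ∧ p = polar ρ w := by
  rcases (dist_nonneg (x := polar r u) (y := polar s v)).eq_or_lt with h0 | h0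
  · have hxz : dist (polar r u) p = 0 := by
      linarith [dist_nonneg (x := polar r u) (y := p), dist_nonneg (x := p) (y := polar s v)]
    exact ⟨r, u, hr, le_rfl, huv, (dist_eq_zero.1 hxz).symm⟩
  have h2 := (hypCoord_of_between h).2
  have h3 := congrArg Complex.re h2
  have h4 := congrArg Complex.im h2
  simp only [Complex.add_re, Complex.add_im, Complex.re_ofReal_mul, Complex.im_ofReal_mul,
    hypCoord_polar] at h3 h4
  have hA : 0 ≤ Real.sinh (dist p (polar s v)) * Real.sinh r :=
    mul_nonneg (Real.sinh_nonneg_iff.2 dist_nonneg) (Real.sinh_nonneg_iff.2 hr)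
  have hB : 0 ≤ Real.sinh (dist (polar r u) p) * Real.sinh s :=
    mul_nonneg (Real.sinh_nonneg_iff.2 dist_nonneg) (Real.sinh_nonneg_iff.2 hs)
  obtain ⟨R, w, hR, hw1, hw2, e1, e2⟩ := polar_shift_comb hA hB huv hpi
  obtain ⟨ρ, hρ, hp⟩ := exists_polar_of_hypCoord (Real.sinh_pos_iff.2 h0) hR
    (h3.trans (by rw [← e1]; ring)) (h4.trans (by rw [← e2]; ring))
  exact ⟨ρ, w, hρ, hw1, hw2, hp⟩

/-- A geodesic segment of angular extent less than `π` meets every ray in between. -/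
lemma exists_crossing {r s u v c : ℝ} (hr : 0 ≤ r) (hs : 0 ≤ s) (huc : u ≤ c) (hcv : c ≤ v)
    (hpi : v < u + Real.pi) :
    ∃ ρ : ℝ, 0 ≤ ρ ∧ dist (polar r u) (polar ρ c) + dist (polar ρ c) (polar s v) =
      dist (polar r u) (polar s v) := by
  rcases hr.eq_or_lt with rfl | hr0
  · exact ⟨0, le_rfl, by rw [polar_zero u c]; simp⟩
  rcases hs.eq_or_lt with rfl | hs0
  · exact ⟨0, le_rfl, by rw [polar_zero v c]; simp⟩
  rcases huc.eq_or_lt with rfl | huc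
  · exact ⟨r, hr, by simp⟩
  have h1 : 0 ≤ Real.sin (v - c) := Real.sin_nonneg_of_nonneg_of_le_pi (by linarith) (by linarith)
  have h2 : 0 < Real.sin (c - u) := Real.sin_pos_of_pos_of_lt_pi (by linarith) (by linarith)
  have h3 : 0 < Real.sin (v - u) := Real.sin_pos_of_pos_of_lt_pi (by linarith) (by linarith)
  have hsr := Real.sinh_pos_iff.2 hr0
  have hss := Real.sinh_pos_iff.2 hs0
  have hl := mul_nonneg hss.le h1
  have hm := mul_pos hsr h2
  -- The weights come from sin(v-c) e^{iu} + sin(c-u) e^{iv} = sin(v-u) e^{ic}: they cancel the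
  -- radii and leave a vector in direction c.
  obtain ⟨p, N, hN, -, hp, hb, -⟩ := exists_between_comb (polar r u) (polar s v) hl hm.le
    (by linarith)
  have e1 := congrArg Complex.re hp
  have e2 := congrArg Complex.im hp
  simp only [Complex.add_re, Complex.add_im, Complex.re_ofReal_mul, Complex.im_ofReal_mul,
    hypCoord_polar] at e1 e2
  obtain ⟨ρ, hρ, rfl⟩ := exists_polar_of_hypCoord (p := p) (w := c) hN
    (R := Real.sinh r * Real.sinh s * Real.sin (v - u)) (by positivity)
    (e1.trans (by
      rw [Real.sin_sub, Real.sin_sub, Real.sin_sub]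
      ring))
    (e2.trans (by
      rw [Real.sin_sub, Real.sin_sub, Real.sin_sub]
      ring))
  exact ⟨ρ, hρ, hb⟩

/-! ### Spaces with hyperbolically convex distance functions -/

/-- The point `p` lies between `y` and `z` at distance `s` from `y`, and at `p` the functions
`cosh (dist x ·)` satisfy the inequality that is an equality in the hyperbolic plane. -/
def IsHyperbolicallyBetween {X : Type*} [PseudoMetricSpace X] (y z : X) (s : ℝ) (p : X) : Prop :=
  dist y p = s ∧ dist p z = dist y z - s ∧
    ∀ x, Real.cosh (dist x p) * Real.sinh (dist y z) ≤
      Real.cosh (dist x y) * Real.sinh (dist y z - s) + Real.cosh (dist x z) * Real.sinh s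

lemma IsHyperbolicallyBetween.symm {X : Type*} [PseudoMetricSpace X] {y z p : X} {s : ℝ}
    (h : IsHyperbolicallyBetween z y (dist y z - s) p) : IsHyperbolicallyBetween y z s p := by
  obtain ⟨h1, h2, h3⟩ := h
  rw [dist_comm z y, sub_sub_cancel] at h2
  refine ⟨by rw [dist_comm, h2], by rw [dist_comm, h1], fun x => ?_⟩
  have := h3 x
  rw [dist_comm z y, sub_sub_cancel] at this
  linarith

/-- Any two points are joined by points at all intermediate distances that satisfy the inequality
of hyperbolic convexity. -/
def HasHyperbolicConvexity (X : Type*) [PseudoMetricSpace X] : Prop :=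
  ∀ y z : X, ∀ s : ℝ, 0 ≤ s → s ≤ dist y z → ∃ p, IsHyperbolicallyBetween y z s p

/-- The inequality is assumed for one chosen q only. Tested at x = p its right side is sinh (dist y
z), so cosh (dist p q) ≤ 1 and q = p. -/
lemma HasHyperbolicConvexity.of_between {X : Type*} [MetricSpace X]
    (H : HasHyperbolicConvexity X) {y p z : X} (h : dist y p + dist p z = dist y z) (x : X) :
    Real.cosh (dist x p) * Real.sinh (dist y z) ≤
      Real.cosh (dist x y) * Real.sinh (dist p z) +
        Real.cosh (dist x z) * Real.sinh (dist y p) := by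
  rcases (dist_nonneg (x := y) (y := z)).eq_or_lt with h0 | h0
  · rw [← h0, Real.sinh_zero, mul_zero]
    exact add_nonneg (mul_nonneg (Real.cosh_pos _).le (Real.sinh_nonneg_iff.2 dist_nonneg))
      (mul_nonneg (Real.cosh_pos _).le (Real.sinh_nonneg_iff.2 dist_nonneg))
  obtain ⟨q, -, -, hq⟩ := H y z (dist y p) dist_nonneg
    (by linarith [dist_nonneg (x := p) (y := z)])
  have hpz : dist y z - dist y p = dist p z := by linarith
  rw [hpz] at hq
  have hpq : q = p := by
    have h1 := hq p
    rw [dist_comm p y] at h1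
    have h2 : Real.cosh (dist p q) * Real.sinh (dist y z) ≤ 1 * Real.sinh (dist y z) := by
      refine h1.trans (le_of_eq ?_)
      rw [one_mul, ← h, Real.sinh_add]
      ring
    have h3 := le_of_mul_le_mul_right h2 (Real.sinh_pos_iff.2 h0)
    rw [← Real.cosh_zero] at h3
    exact (dist_le_zero.1 (le_of_cosh_le dist_nonneg le_rfl h3)).symm
  rw [← hpq] at h ⊢
  have := hq x
  rwa [hpq] at this ⊢

lemma HasHyperbolicConvexity.isGeodesicSpace {X : Type*} [MetricSpace X]
    (H : HasHyperbolicConvexity X) : IsGeodesicSpace X := by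
  intro y z
  rcases eq_or_ne y z with rfl | hyz
  · refine ⟨fun _ => y, rfl, rfl, ?_⟩
    intro s hs t ht
    rw [dist_self, Set.Icc_self] at hs ht
    rw [Set.mem_singleton_iff] at hs ht
    simp [hs, ht]
  have hd : 0 < dist y z := dist_pos.2 hyz
  have : Nonempty X := ⟨y⟩
  unfold HasHyperbolicConvexity IsHyperbolicallyBetween at H
  choose! γ h1 h2 h3 using H y z
  refine ⟨γ, ?_, ?_, ?_⟩
  · exact (dist_eq_zero.1 (h1 0 le_rfl hd.le)).symm
  · exact dist_eq_zero.1 (by rw [h2 _ hd.le le_rfl, sub_self])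
  rintro s ⟨hs0, hs1⟩ t ⟨ht0, ht1⟩
  apply le_antisymm
  -- The points γ s were chosen independently of each other. The inequality for γ t, tested at γ s,
  -- has right side cosh (s - t) sinh (dist y z).
  · refine le_of_cosh_le dist_nonneg (abs_nonneg _) ?_
    refine le_of_mul_le_mul_right ((h3 t ht0 ht1 (γ s)).trans (le_of_eq ?_))
      (Real.sinh_pos_iff.2 hd)
    rw [dist_comm, h1 s hs0 hs1, h2 s hs0 hs1, Real.cosh_abs, Real.cosh_sub, Real.cosh_sub,
      Real.sinh_sub]
    ring
  · have h4 := abs_dist_sub_le (γ s) (γ t) y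
    rwa [dist_comm (γ s) y, dist_comm (γ t) y, h1 s hs0 hs1, h1 t ht0 ht1] at h4

/-- Stewart's relation is an inequality in `X` and an equality in the plane. Only upper bounds on
the distances from `w` are needed, so the lemma can be applied twice to compare two points on two
sides. -/
lemma HasHyperbolicConvexity.dist_le_comparison {X : Type*} [MetricSpace X]
    (H : HasHyperbolicConvexity X) {x y p w : X} {x' y' p' w' : ℍ}
    (hxy : dist x' y' = dist x y) (hb : dist x p + dist p y = dist x y)
    (hxp : dist x' p' = dist x p) (hpy : dist p' y' = dist p y)
    (hx : dist w x ≤ dist w' x') (hy : dist w y ≤ dist w' y') : dist w p ≤ dist w' p' := by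
  rcases (dist_nonneg (x := x) (y := y)).eq_or_lt with h0 | h0
  · have hp : dist x p = 0 := by
      linarith [dist_nonneg (x := x) (y := p), dist_nonneg (x := p) (y := y)]
    rw [hp] at hxp
    rwa [← dist_eq_zero.1 hp, ← dist_eq_zero.1 hxp]
  refine le_of_cosh_le dist_nonneg dist_nonneg ?_
  refine le_of_mul_le_mul_right ?_ (Real.sinh_pos_iff.2 h0)
  refine (H.of_between hb w).trans ?_
  have hs := hyperbolic_stewart (y := x') (p := p') (z := y') (by rw [hxp, hpy, hxy, hb]) w'
  rw [hxy, hxp, hpy] at hs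
  rw [hs]
  have hcx : Real.cosh (dist w x) ≤ Real.cosh (dist w' x') := by
    rw [Real.cosh_le_cosh, abs_of_nonneg dist_nonneg, abs_of_nonneg dist_nonneg]; exact hx
  have hcy : Real.cosh (dist w y) ≤ Real.cosh (dist w' y') := by
    rw [Real.cosh_le_cosh, abs_of_nonneg dist_nonneg, abs_of_nonneg dist_nonneg]; exact hy
  exact add_le_add (mul_le_mul_of_nonneg_right hcx (Real.sinh_nonneg_iff.2 dist_nonneg))
    (mul_le_mul_of_nonneg_right hcy (Real.sinh_nonneg_iff.2 dist_nonneg))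

lemma HasHyperbolicConvexity.isCATNegOne {X : Type*} [MetricSpace X]
    (H : HasHyperbolicConvexity X) (hc : CompleteSpace X) : IsCATNegOne X where
  complete := hc
  geodesic := H.isGeodesicSpace
  thin := by
    intro x y z p q x' y' z' p' q' hxy hxz hyz hp hq hxp hpy hxq hqz
    have hzp : dist z p ≤ dist z' p' := by
      refine H.dist_le_comparison hxy hp hxp hpy ?_ ?_
      · rw [dist_comm, ← hxz, dist_comm]
      · rw [dist_comm, ← hyz, dist_comm]
    refine H.dist_le_comparison hxz hq hxq hqz ?_ ?_
    · rw [dist_comm, ← hxp, dist_comm]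
    · rwa [dist_comm, dist_comm p']

/-- Hyperbolic convexity passes to the associated metric space. -/
lemma HasHyperbolicConvexity.separationQuotient {X : Type*} [PseudoMetricSpace X]
    (H : HasHyperbolicConvexity X) : HasHyperbolicConvexity (SeparationQuotient X) := by
  intro y z
  obtain ⟨y, rfl⟩ := SeparationQuotient.surjective_mk y
  obtain ⟨z, rfl⟩ := SeparationQuotient.surjective_mk z
  intro s hs0 hs1
  rw [SeparationQuotient.dist_mk] at hs1
  obtain ⟨p, h1, h2, h3⟩ := H y z s hs0 hs1
  refine ⟨SeparationQuotient.mk p, h1, h2, fun x => ?_⟩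
  obtain ⟨x, rfl⟩ := SeparationQuotient.surjective_mk x
  exact h3 x

/-! ### The hyperbolic cone over a circle -/

/-- Points of the hyperbolic cone over the circle of length `L`, in polar coordinates. -/
structure HypCone (L : ℝ) where
  /-- The distance from the cone point. -/
  rad : ℝ
  /-- The direction. -/
  ang : AddCircle L
  rad_nonneg : 0 ≤ rad

namespace HypCone

variable {L : ℝ}

/-- The angle at the cone point. -/
def angle (x y : HypCone L) : ℝ := min Real.pi ‖x.ang - y.ang‖

lemma angle_nonneg (x y : HypCone L) : 0 ≤ angle x y := le_min Real.pi_pos.le (norm_nonneg _)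

lemma angle_le_pi (x y : HypCone L) : angle x y ≤ Real.pi := min_le_left _ _

lemma angle_comm (x y : HypCone L) : angle x y = angle y x := by
  rw [angle, angle, norm_sub_rev]

lemma angle_triangle (x y z : HypCone L) :
    angle x z ≤ min Real.pi (angle x y + angle y z) := by
  refine le_min (angle_le_pi _ _) ?_
  have h : ‖x.ang - z.ang‖ ≤ ‖x.ang - y.ang‖ + ‖y.ang - z.ang‖ :=
    norm_sub_le_norm_sub_add_norm_sub _ _ _
  have h1 := norm_nonneg (x.ang - y.ang)
  have h2 := norm_nonneg (y.ang - z.ang)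
  have := Real.pi_pos
  simp only [angle, min_def]
  split_ifs <;> linarith

instance : Dist (HypCone L) := ⟨fun x y => dist (polar x.rad 0) (polar y.rad (angle x y))⟩

lemma dist_def (x y : HypCone L) : dist x y = dist (polar x.rad 0) (polar y.rad (angle x y)) := rfl

lemma dist_eq_of_cos {x y : HypCone L} {φ ψ : ℝ} (h : Real.cos (angle x y) = Real.cos (φ - ψ)) :
    dist x y = dist (polar x.rad φ) (polar y.rad ψ) := by
  rw [dist_def]
  apply dist_polar_congr
  rw [← h, zero_sub, Real.cos_neg]

lemma le_dist_of_cos {x y : HypCone L} {φ ψ : ℝ} (h : Real.cos (angle x y) ≤ Real.cos (φ - ψ)) :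
    dist (polar x.rad φ) (polar y.rad ψ) ≤ dist x y := by
  rw [dist_def]
  refine dist_polar_le x.rad_nonneg y.rad_nonneg ?_
  rwa [zero_sub, Real.cos_neg]

lemma dist_le_of_cos {x y : HypCone L} {φ ψ : ℝ} (h : Real.cos (φ - ψ) ≤ Real.cos (angle x y)) :
    dist x y ≤ dist (polar x.rad φ) (polar y.rad ψ) := by
  rw [dist_def]
  refine dist_polar_le x.rad_nonneg y.rad_nonneg ?_
  rwa [zero_sub, Real.cos_neg]

/-- Only a pseudometric: the cone point has one representative for each direction. -/
instance : PseudoMetricSpace (HypCone L) where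
  dist_self x := by
    have : angle x x = 0 := by simp [angle, Real.pi_pos.le]
    rw [dist_def, this, dist_self]
  dist_comm x y := by
    rw [dist_eq_of_cos (x := y) (y := x) (φ := angle x y) (ψ := 0)
      (by rw [sub_zero, angle_comm]), dist_comm, dist_def]
  dist_triangle x y z := by
    have h1 := angle_triangle x y z
    -- The two triangles at the cone point are laid side by side in the plane, with total angle
    -- truncated at π; there the triangle inequality is known.
    set θ := min Real.pi (angle x y + angle y z) with hθ
    have hxy : angle x y ≤ θ :=
      le_min (angle_le_pi _ _) (by linarith [angle_nonneg y z])
    have h2 : θ ≤ angle x y + angle y z := min_le_right _ _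
    have h3 : θ ≤ Real.pi := min_le_left _ _
    calc dist x z ≤ dist (polar x.rad 0) (polar z.rad θ) := by
          refine dist_le_of_cos ?_
          rw [zero_sub, Real.cos_neg]
          exact Real.cos_le_cos_of_nonneg_of_le_pi (angle_nonneg _ _) h3 h1
      _ ≤ dist (polar x.rad 0) (polar y.rad (angle x y)) +
          dist (polar y.rad (angle x y)) (polar z.rad θ) := dist_triangle _ _ _
      _ ≤ dist x y + dist y z := by
          refine add_le_add le_rfl (le_dist_of_cos ?_)
          rw [← Real.cos_neg (angle x y - θ)]
          exact Real.cos_le_cos_of_nonneg_of_le_pi (by linarith) (angle_le_pi _ _) (by linarith)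

lemma cosh_dist (x y : HypCone L) : Real.cosh (dist x y) =
    Real.cosh x.rad * Real.cosh y.rad -
      Real.sinh x.rad * Real.sinh y.rad * Real.cos (angle x y) := by
  rw [dist_def, cosh_dist_polar, zero_sub, Real.cos_neg]

lemma dist_le_rad_add_rad (x y : HypCone L) : dist x y ≤ x.rad + y.rad := by
  rw [← dist_polar_opposite x.rad_nonneg y.rad_nonneg 0]
  refine dist_le_of_cos ?_
  rw [zero_add, zero_sub, Real.cos_neg, Real.cos_pi]
  exact Real.neg_one_le_cos _

lemma dist_eq_rad_add_rad {x y : HypCone L} (h : Real.pi ≤ ‖x.ang - y.ang‖) :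
    dist x y = x.rad + y.rad := by
  rw [← dist_polar_opposite x.rad_nonneg y.rad_nonneg 0]
  refine dist_eq_of_cos ?_
  rw [angle, min_eq_left h, zero_add, zero_sub, Real.cos_neg]

lemma dist_eq_of_ang_eq {x y : HypCone L} (h : x.ang = y.ang) : dist x y = |x.rad - y.rad| := by
  rw [← dist_polar_same _ _ 0]
  refine dist_eq_of_cos ?_
  simp [angle, h, Real.pi_pos.le]

lemma norm_coe_eq (hL : 2 * Real.pi ≤ L) {δ : ℝ} (h : |δ| ≤ Real.pi) :
    ‖(δ : AddCircle L)‖ = |δ| := by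
  have := Real.pi_pos
  rw [AddCircle.norm_coe_eq_abs_iff L (by linarith : (0 : ℝ) < L).ne',
    abs_of_pos (by linarith : 0 < L)]
  linarith

/-- Sectors of angle at most `π` embed isometrically into the hyperbolic plane. -/
lemma dist_eq_polar (hL : 2 * Real.pi ≤ L) {x y : HypCone L} {u v : ℝ} (hx : x.ang = u)
    (hy : y.ang = v) (h : |u - v| ≤ Real.pi) :
    dist x y = dist (polar x.rad u) (polar y.rad v) := by
  refine dist_eq_of_cos ?_
  rw [angle, hx, hy, ← AddCircle.coe_sub, norm_coe_eq hL h, min_eq_right h, Real.cos_abs]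

lemma cos_min_pi_le (a : ℝ) : Real.cos (min Real.pi a) ≤ Real.cos a := by
  rcases le_total a Real.pi with h | h
  · rw [min_eq_right h]
  · rw [min_eq_left h, Real.cos_pi]
    exact Real.neg_one_le_cos _

/-- If the nearest multiple kL of the period is not 0, then |δ - kL| ≥ 2π - |δ|, and the latter has
the same cosine as δ. Hence the cone never sees a smaller angle than the plane; this is where total
angle at least 2π enters. -/
lemma cos_min_pi_norm_le (hL : 2 * Real.pi ≤ L) {δ : ℝ} (h : |δ| ≤ 2 * Real.pi) :
    Real.cos (min Real.pi ‖(δ : AddCircle L)‖) ≤ Real.cos δ := by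
  have hpi := Real.pi_pos
  rw [AddCircle.norm_eq]
  generalize round (L⁻¹ * δ) = k
  rcases eq_or_ne k 0 with rfl | hk
  · simpa using cos_min_pi_le |δ|
  · have hk1 : (1 : ℝ) ≤ |(k : ℝ)| := by
      rw [← Int.cast_abs]
      exact_mod_cast Int.one_le_abs hk
    have h1 : L ≤ |(k : ℝ) * L| := by
      rw [abs_mul, abs_of_pos (by linarith : 0 < L)]
      nlinarith
    have h2 : |(k : ℝ) * L| - |δ| ≤ |δ - k * L| := by
      rw [abs_sub_comm]; exact abs_sub_abs_le_abs_sub _ _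
    have h3 : 0 ≤ 2 * Real.pi - |δ| := by linarith
    calc Real.cos (min Real.pi |δ - k * L|) ≤ Real.cos (min Real.pi (2 * Real.pi - |δ|)) := by
          refine Real.cos_le_cos_of_nonneg_of_le_pi (le_min hpi.le h3) (min_le_left _ _) ?_
          exact min_le_min le_rfl (by linarith)
      _ ≤ Real.cos (2 * Real.pi - |δ|) := cos_min_pi_le _
      _ = Real.cos δ := by rw [Real.cos_two_pi_sub, Real.cos_abs]

lemma exists_lift (a : AddCircle L) : ∃ δ : ℝ, (δ : AddCircle L) = a ∧ ‖a‖ = |δ| := by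
  induction a using QuotientAddGroup.induction_on with
  | H x =>
    refine ⟨x - round (L⁻¹ * x) * L, ?_, AddCircle.norm_eq L⟩
    have : ((round (L⁻¹ * x) * L : ℝ) : AddCircle L) = 0 :=
      AddCircle.coe_eq_zero_iff L |>.2 ⟨round (L⁻¹ * x), by simp⟩
    rw [AddCircle.coe_sub, this, sub_zero]

/-- Comparison with the hyperbolic plane: the cone is folded onto the hyperbolic plane by a map
that is isometric on the ray in direction `w`, on the half plane around it and on opposite rays. -/
lemma exists_comparison (hL : 2 * Real.pi ≤ L) (w : ℝ) (x : HypCone L) : ∃ ψ : ℝ,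
    (∀ (y : HypCone L) (u : ℝ), y.ang = u → |u - w| ≤ Real.pi →
      dist (polar x.rad ψ) (polar y.rad u) ≤ dist x y) ∧
    (∀ y : HypCone L, y.ang = w → dist (polar x.rad ψ) (polar y.rad w) = dist x y) ∧
    ∀ y : HypCone L, Real.pi ≤ ‖y.ang - w‖ →
      dist (polar x.rad ψ) (polar y.rad (w + Real.pi)) ≤ dist x y := by
  have hpi := Real.pi_pos
  obtain ⟨δ, hδ, hδn⟩ := exists_lift (x.ang - (w : AddCircle L))
  have hxa : x.ang = ((δ + w : ℝ) : AddCircle L) := by rw [AddCircle.coe_add, hδ]; abel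
  -- If `x` is within angle π of `w` it keeps its direction; otherwise its truncated angle to `w` is
  -- π and it is placed opposite to `w`.
  rcases le_total |δ| Real.pi with h | h
  · refine ⟨δ + w, fun y u hy hu => le_dist_of_cos ?_, fun y hy => (dist_eq_of_cos ?_).symm,
      fun y hy => le_dist_of_cos ?_⟩
    · rw [angle, hxa, hy, ← AddCircle.coe_sub]
      refine cos_min_pi_norm_le hL ?_
      rw [show δ + w - u = δ - (u - w) by ring]
      exact (abs_sub _ _).trans (by linarith)
    · rw [angle, hy, hδn, min_eq_right h, add_sub_cancel_right, Real.cos_abs]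
    · rw [show δ + w - (w + Real.pi) = δ - Real.pi by ring, Real.cos_sub_pi, ← Real.cos_abs δ,
        ← Real.cos_pi_sub]
      have h1 : Real.pi - |δ| ≤ ‖x.ang - y.ang‖ := by
        have : ‖y.ang - (w : AddCircle L)‖ ≤ ‖x.ang - (w : AddCircle L)‖ + ‖x.ang - y.ang‖ := by
          rw [show y.ang - (w : AddCircle L) = (x.ang - w) - (x.ang - y.ang) by abel]
          exact norm_sub_le _ _
        rw [hδn] at this
        linarith
      exact Real.cos_le_cos_of_nonneg_of_le_pi (by linarith) (angle_le_pi _ _)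
        (le_min (by linarith [abs_nonneg δ]) h1)
  · refine ⟨w + Real.pi, fun y u hy hu => le_dist_of_cos ?_, fun y hy => (dist_eq_of_cos ?_).symm,
      fun y hy => le_dist_of_cos ?_⟩
    · rw [show w + Real.pi - u = Real.pi - (u - w) by ring, Real.cos_pi_sub, ← Real.cos_abs (u - w),
        ← Real.cos_pi_sub]
      have h1 : Real.pi - |u - w| ≤ ‖x.ang - y.ang‖ := by
        have h2 : ‖x.ang - w‖ ≤ ‖x.ang - y.ang‖ + ‖y.ang - w‖ :=
          norm_sub_le_norm_sub_add_norm_sub _ _ _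
        rw [hδn, hy, ← AddCircle.coe_sub, norm_coe_eq hL hu, ← hy] at h2
        linarith
      exact Real.cos_le_cos_of_nonneg_of_le_pi (by linarith) (angle_le_pi _ _)
        (le_min (by linarith [abs_nonneg (u - w)]) h1)
    · rw [angle, hy, hδn, min_eq_left h, add_sub_cancel_left]
    · rw [sub_self, Real.cos_zero]
      exact Real.cos_le_one _

end HypCone

/-! ### Geodesics of the cone -/

namespace HypCone

variable {L : ℝ}

/-- Geodesics of the cone that do not meet the cone point. -/
lemma exists_between_of_angle_lt (hL : 2 * Real.pi ≤ L) {y z : HypCone L} {u v : ℝ}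
    (hy : y.ang = u) (hz : z.ang = v) (huv : u ≤ v) (hpi : v < u + Real.pi) {s : ℝ}
    (hs0 : 0 ≤ s) (hs : s ≤ dist y z) :
    ∃ (p : HypCone L) (w : ℝ), p.ang = w ∧ u ≤ w ∧ w ≤ v ∧
      dist (polar y.rad u) (polar p.rad w) + dist (polar p.rad w) (polar z.rad v) =
        dist (polar y.rad u) (polar z.rad v) ∧ IsHyperbolicallyBetween y z s p := by
  have hyz : dist y z = dist (polar y.rad u) (polar z.rad v) :=
    dist_eq_polar hL hy hz (abs_le.2 ⟨by linarith, by linarith⟩)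
  obtain ⟨p', h1, h2⟩ := exists_dist_eq (polar y.rad u) (polar z.rad v) hs0 (hyz ▸ hs)
  obtain ⟨ρ, w, hρ, huw, hwv, rfl⟩ := exists_polar_of_between y.rad_nonneg z.rad_nonneg huv hpi
    (p := p') (by rw [h1, h2]; ring)
  refine ⟨⟨ρ, w, hρ⟩, w, rfl, huw, hwv, by rw [h1, h2]; ring, ?_, ?_, fun x => ?_⟩
  · rw [dist_eq_polar hL hy rfl (abs_le.2 ⟨by linarith, by linarith⟩), h1]
  · rw [dist_eq_polar hL rfl hz (abs_le.2 ⟨by linarith, by linarith⟩), h2, hyz]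
  -- Unfolding `x` about the direction of the new point keeps its distance to that point and does
  -- not increase those to `y` and `z`, so Stewart's equality in the plane gives the inequality.
  obtain ⟨ψ, hψ1, hψ2, -⟩ := exists_comparison hL w x
  have hS := hyperbolic_stewart (y := polar y.rad u) (p := polar ρ w) (z := polar z.rad v)
    (by rw [h1, h2]; ring) (polar x.rad ψ)
  rw [hψ2 ⟨ρ, w, hρ⟩ rfl, h1, h2, ← hyz] at hS
  rw [hS]
  have hcy := Real.cosh_le_cosh.2 (abs_le_abs_of_nonneg dist_nonneg
    (hψ1 y u hy (abs_le.2 ⟨by linarith, by linarith⟩)))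
  have hcz := Real.cosh_le_cosh.2 (abs_le_abs_of_nonneg dist_nonneg
    (hψ1 z v hz (abs_le.2 ⟨by linarith, by linarith⟩)))
  exact add_le_add (mul_le_mul_of_nonneg_right hcy (Real.sinh_nonneg_iff.2 (by linarith)))
    (mul_le_mul_of_nonneg_right hcz (Real.sinh_nonneg_iff.2 hs0))

/-- Geodesics of the cone through the cone point. -/
lemma isHyperbolicallyBetween_of_pi_le (hL : 2 * Real.pi ≤ L) {y z p : HypCone L}
    (hyz : Real.pi ≤ ‖z.ang - y.ang‖) (hp : p.ang = y.ang) (hr : p.rad ≤ y.rad) :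
    IsHyperbolicallyBetween y z (y.rad - p.rad) p := by
  obtain ⟨u, hu, -⟩ := exists_lift y.ang
  have hpr := p.rad_nonneg
  have hzr := z.rad_nonneg
  have d1 : dist y p = y.rad - p.rad := by
    rw [dist_eq_of_ang_eq hp.symm, abs_of_nonneg (by linarith)]
  have d2 : dist p z = p.rad + z.rad := dist_eq_rad_add_rad (by rwa [norm_sub_rev, hp])
  have d3 : dist y z = y.rad + z.rad := dist_eq_rad_add_rad (by rwa [norm_sub_rev])
  refine ⟨d1, by rw [d2, d3]; ring, fun x => ?_⟩
  obtain ⟨ψ, -, hψ2, hψ3⟩ := exists_comparison hL u x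
  have e1 : dist (polar y.rad u) (polar p.rad u) = y.rad - p.rad := by
    rw [dist_polar_same, abs_of_nonneg (by linarith)]
  have e2 := dist_polar_opposite hpr hzr u
  have e3 := dist_polar_opposite y.rad_nonneg hzr u
  have hS := hyperbolic_stewart (y := polar y.rad u) (p := polar p.rad u)
    (z := polar z.rad (u + Real.pi)) (by rw [e1, e2, e3]; ring) (polar x.rad ψ)
  rw [hψ2 p (hp.trans hu.symm), hψ2 y hu.symm, e1, e2, e3] at hS
  rw [d3, hS, show y.rad + z.rad - (y.rad - p.rad) = p.rad + z.rad by ring]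
  have hcz := Real.cosh_le_cosh.2 (abs_le_abs_of_nonneg dist_nonneg (hψ3 z (by rwa [hu])))
  exact add_le_add le_rfl
    (mul_le_mul_of_nonneg_right hcz (Real.sinh_nonneg_iff.2 (by linarith)))

end HypCone

/-! ### Four sectors arranged cyclically -/

/-- A decomposition of the circle of length `L` into four cyclically ordered arcs of length at most
`π`, such that any two consecutive arcs form a half circle. -/
structure CyclicSectors (L : ℝ) where
  /-- The lengths of the arcs. -/
  angle : Fin 4 → ℝ
  /-- The initial points of the arcs. -/
  start : Fin 4 → AddCircle L
  angle_pos : ∀ i, 0 < angle i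
  angle_le_pi : ∀ i, angle i ≤ Real.pi
  start_succ : ∀ i, start (i + 1) = start i + angle i
  angle_add : ∀ i, angle i + angle (i + 1) = L / 2
  two_pi_le : 2 * Real.pi ≤ L

namespace CyclicSectors

variable {L : ℝ} (S : CyclicSectors L)

lemma length_pos (S : CyclicSectors L) : 0 < L := by linarith [S.two_pi_le, Real.pi_pos]

lemma angle_add_two (i : Fin 4) : S.angle (i + 2) = S.angle i := by
  have h1 := S.angle_add i
  have h2 := S.angle_add (i + 1)
  rw [add_assoc, show (1 : Fin 4) + 1 = 2 from rfl] at h2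
  linarith

lemma start_add_two (i : Fin 4) : S.start (i + 2) = S.start i + ((L / 2 : ℝ) : AddCircle L) := by
  rw [show i + 2 = (i + 1) + 1 by rw [add_assoc]; rfl, S.start_succ, S.start_succ, add_assoc,
    ← AddCircle.coe_add, S.angle_add]

lemma angle_lt_half (i : Fin 4) : S.angle i < L / 2 := by
  linarith [S.angle_add i, S.angle_pos (i + 1)]

lemma exists_start_add (a : AddCircle L) :
    ∃ i, ∃ φ ∈ Set.Icc 0 (S.angle i), a = S.start i + (φ : ℝ) := by
  have hL := S.length_pos
  -- Two consecutive arcs cover a half circle; the half circles starting with the arcs 0 and 2 cover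
  -- everything.
  have key : ∀ i, ∀ x ∈ Set.Ico 0 (L / 2), ∃ j, ∃ φ ∈ Set.Icc 0 (S.angle j),
      S.start i + ((x : ℝ) : AddCircle L) = S.start j + (φ : ℝ) := by
    intro i x hx
    rcases le_total x (S.angle i) with h | h
    · exact ⟨i, x, ⟨hx.1, h⟩, rfl⟩
    · refine ⟨i + 1, x - S.angle i, ⟨by linarith, by linarith [S.angle_add i, hx.2]⟩, ?_⟩
      rw [S.start_succ, add_assoc, ← AddCircle.coe_add, add_sub_cancel]
  have : Fact (0 < L) := ⟨hL⟩
  obtain ⟨x, hx, hxa⟩ : ∃ x ∈ Set.Ico 0 (0 + L), ((x : ℝ) : AddCircle L) = a - S.start 0 := by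
    have h := AddCircle.coe_image_Ico_eq L 0
    have h2 : a - S.start 0 ∈ (Set.univ : Set (AddCircle L)) := trivial
    rw [← h] at h2
    exact h2
  have ha : a = S.start 0 + (x : AddCircle L) := by rw [hxa]; abel
  rcases lt_or_ge x (L / 2) with h | h
  · obtain ⟨j, φ, hφ, e⟩ := key 0 x ⟨hx.1, h⟩
    exact ⟨j, φ, hφ, ha.trans e⟩
  · obtain ⟨j, φ, hφ, e⟩ := key 2 (x - L / 2) ⟨by linarith, by linarith [hx.2]⟩
    refine ⟨j, φ, hφ, ha.trans (e ▸ ?_)⟩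
    have h2 := S.start_add_two 0
    rw [zero_add] at h2
    rw [h2, add_assoc, ← AddCircle.coe_add, add_sub_cancel]

lemma eq_zero_of_coe_eq_zero {x : ℝ} (hx : (x : AddCircle L) = 0) (h : |x| < L) : x = 0 := by
  obtain ⟨n, rfl⟩ := AddCircle.coe_eq_zero_iff L |>.1 hx
  have hL : 0 < L := (abs_nonneg _).trans_lt h
  rw [zsmul_eq_mul, abs_mul, abs_of_pos hL] at h
  have h1 : |(n : ℝ)| < 1 := by
    by_contra! h2
    nlinarith
  have : n = 0 := Int.abs_lt_one_iff.1 (by exact_mod_cast h1)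
  simp [this]

lemma not_start_add_two_eq {i : Fin 4} {φ φ' : ℝ} (hφ : φ ∈ Set.Icc 0 (S.angle i))
    (hφ' : φ' ∈ Set.Icc 0 (S.angle (i + 2))) :
    S.start i + (φ : AddCircle L) ≠ S.start (i + 2) + (φ' : ℝ) := by
  intro h
  have h1 := S.angle_lt_half i
  have hL := S.length_pos
  rw [S.angle_add_two] at hφ'
  rw [S.start_add_two, add_assoc, add_right_inj, ← AddCircle.coe_add, ← sub_eq_zero,
    ← AddCircle.coe_sub] at h
  have h3 := eq_zero_of_coe_eq_zero h
    (abs_lt.2 ⟨by linarith [hφ.1, hφ'.2], by linarith [hφ.2, hφ'.1]⟩)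
  linarith [hφ.2, hφ'.1]

lemma start_add_succ_eq {i : Fin 4} {φ φ' : ℝ} (hφ : φ ∈ Set.Icc 0 (S.angle i))
    (hφ' : φ' ∈ Set.Icc 0 (S.angle (i + 1)))
    (h : S.start i + (φ : AddCircle L) = S.start (i + 1) + (φ' : ℝ)) :
    φ = S.angle i ∧ φ' = 0 := by
  have h1 := S.angle_add i
  have hL := S.length_pos
  rw [S.start_succ, add_assoc, add_right_inj, ← AddCircle.coe_add, ← sub_eq_zero,
    ← AddCircle.coe_sub] at h
  have h3 := eq_zero_of_coe_eq_zero h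
    (abs_lt.2 ⟨by linarith [hφ.1, hφ'.2], by linarith [hφ.2, hφ'.1]⟩)
  exact ⟨by linarith [hφ.2, hφ'.1], by linarith [hφ.2, hφ'.1]⟩

lemma start_add_self_eq {i : Fin 4} {φ φ' : ℝ} (hφ : φ ∈ Set.Icc 0 (S.angle i))
    (hφ' : φ' ∈ Set.Icc 0 (S.angle i))
    (h : S.start i + (φ : AddCircle L) = S.start i + (φ' : ℝ)) : φ = φ' := by
  have h1 := S.angle_lt_half i
  have hL := S.length_pos
  rw [add_right_inj, ← sub_eq_zero, ← AddCircle.coe_sub] at h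
  have h3 := eq_zero_of_coe_eq_zero h
    (abs_lt.2 ⟨by linarith [hφ.1, hφ'.2], by linarith [hφ.2, hφ'.1]⟩)
  linarith

/-- The part of the cone that is covered by the ideal triangles in the four sectors. -/
def Covers (x : HypCone L) : Prop :=
  ∃ i, ∃ φ ∈ Set.Icc 0 (S.angle i),
    x.ang = S.start i + (φ : ℝ) ∧ polar x.rad φ ∈ sectorTriangle (S.angle i)

lemma polar_zero_mem_sectorTriangle {r : ℝ} (hr : 0 ≤ r) (θ : ℝ) : polar r 0 ∈ sectorTriangle θ :=
  left_mem_idealTriangle (fun t => polar t 0) (fun t => polar t θ) hr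

lemma polar_mem_sectorTriangle {r : ℝ} (hr : 0 ≤ r) (θ : ℝ) : polar r θ ∈ sectorTriangle θ :=
  right_mem_idealTriangle (fun t => polar t 0) (fun t => polar t θ) hr

lemma cyclic_trichotomy : ∀ i k : Fin 4, i = k ∨ i = k + 1 ∨ i = k + 2 ∨ k = i + 1 := by
  decide

/-- Two different sectors that contain the same direction share it as a bounding ray, and that ray
lies in both triangles. So membership can be tested in any sector containing the direction. -/
lemma Covers.polar_mem {S : CyclicSectors L} {x : HypCone L} (hx : S.Covers x) {k : Fin 4} {φ : ℝ}
    (hφ : φ ∈ Set.Icc 0 (S.angle k)) (ha : x.ang = S.start k + (φ : ℝ)) :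
    polar x.rad φ ∈ sectorTriangle (S.angle k) := by
  obtain ⟨i, φ', hφ', ha', hmem⟩ := hx
  have heq := ha.symm.trans ha'
  obtain rfl | rfl | rfl | rfl : i = k ∨ i = k + 1 ∨ i = k + 2 ∨ k = i + 1 :=
    cyclic_trichotomy i k
  · rwa [S.start_add_self_eq hφ hφ' heq]
  · rw [(S.start_add_succ_eq hφ hφ' heq).1]
    exact polar_mem_sectorTriangle x.rad_nonneg _
  · exact absurd heq (S.not_start_add_two_eq hφ hφ')
  · rw [(S.start_add_succ_eq hφ' hφ heq.symm).2]
    exact polar_zero_mem_sectorTriangle x.rad_nonneg _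

lemma Covers.of_ang_eq {S : CyclicSectors L} {y p : HypCone L} (hy : S.Covers y)
    (hp : p.ang = y.ang) (hr : p.rad ≤ y.rad) : S.Covers p := by
  obtain ⟨i, φ, hφ, ha, hmem⟩ := hy
  refine ⟨i, φ, hφ, hp.trans ha, ?_⟩
  refine isGeodesicallyConvex_idealTriangle _ _ (polar 0 φ) ?_ _ hmem _ ?_
  · rw [polar_zero φ 0]
    exact polar_zero_mem_sectorTriangle le_rfl _
  · have := p.rad_nonneg
    rw [dist_polar_zero p.rad_nonneg, dist_polar_zero y.rad_nonneg, dist_polar_same,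
      abs_sub_comm, abs_of_nonneg (by linarith)]
    ring

/-- The segment is cut at the bounding rays of the sector containing `p`. These rays lie in the
ideal triangle, so `p` is between two points of one convex triangle. -/
lemma Covers.of_between {S : CyclicSectors L} {y z p : HypCone L} (hy : S.Covers y)
    (hz : S.Covers z) {u v w : ℝ} (hyu : y.ang = u) (hzv : z.ang = v) (hpw : p.ang = w)
    (huw : u ≤ w) (hwv : w ≤ v) (hpi : v < u + Real.pi)
    (hb : dist (polar y.rad u) (polar p.rad w) + dist (polar p.rad w) (polar z.rad v) =
      dist (polar y.rad u) (polar z.rad v)) : S.Covers p := by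
  obtain ⟨k, φ, hφ, hk⟩ := S.exists_start_add p.ang
  refine ⟨k, φ, hφ, hk, ?_⟩
  -- The real lift of the start of the sector that matches the lift `w`: the sector becomes the
  -- interval from B to B + `S.angle k`.
  set B := w - φ with hB
  have hkB : S.start k = (B : ℝ) := by
    rw [hB, AddCircle.coe_sub, ← hpw, hk, add_sub_cancel_right]
  have hφ0 := hφ.1
  have hφ1 := hφ.2
  -- From `p` back towards `y`: the point is `y` itself if it lies in this sector, otherwise the
  -- crossing with the initial ray.
  obtain ⟨r₁, c₁, hc₁u, hc₁w, hc₁, hd₁⟩ : ∃ r c : ℝ, u ≤ c ∧ c ≤ w ∧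
      polar r (c - B) ∈ sectorTriangle (S.angle k) ∧
      dist (polar y.rad u) (polar r c) + dist (polar r c) (polar p.rad w) =
        dist (polar y.rad u) (polar p.rad w) := by
    rcases le_total B u with h | h
    · refine ⟨y.rad, u, le_rfl, huw, hy.polar_mem ⟨by linarith, by linarith⟩ ?_, by simp⟩
      rw [hyu, hkB, ← AddCircle.coe_add, add_sub_cancel]
    · obtain ⟨ρ, hρ, h1⟩ := exists_crossing y.rad_nonneg p.rad_nonneg h
        (by linarith : B ≤ w) (by linarith)
      refine ⟨ρ, B, h, by linarith, ?_, h1⟩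
      rw [sub_self]
      exact polar_zero_mem_sectorTriangle hρ _
  obtain ⟨r₂, c₂, hc₂w, hc₂v, hc₂, hd₂⟩ : ∃ r c : ℝ, w ≤ c ∧ c ≤ v ∧
      polar r (c - B) ∈ sectorTriangle (S.angle k) ∧
      dist (polar p.rad w) (polar r c) + dist (polar r c) (polar z.rad v) =
        dist (polar p.rad w) (polar z.rad v) := by
    rcases le_total v (B + S.angle k) with h | h
    · refine ⟨z.rad, v, hwv, le_rfl, hz.polar_mem ⟨by linarith, by linarith⟩ ?_, by simp⟩
      rw [hzv, hkB, ← AddCircle.coe_add, add_sub_cancel]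
    · obtain ⟨ρ, hρ, h1⟩ := exists_crossing p.rad_nonneg z.rad_nonneg
        (by linarith : w ≤ B + S.angle k) h (by linarith)
      refine ⟨ρ, B + S.angle k, by linarith, h, ?_, h1⟩
      rw [add_sub_cancel_left]
      exact polar_mem_sectorTriangle hρ _
  refine isGeodesicallyConvex_idealTriangle _ _ _ hc₁ _ hc₂ _ ?_
  have e1 : dist (polar r₁ (c₁ - B)) (polar p.rad φ) = dist (polar r₁ c₁) (polar p.rad w) :=
    dist_polar_congr (by congr 1; linarith)
  have e2 : dist (polar p.rad φ) (polar r₂ (c₂ - B)) = dist (polar p.rad w) (polar r₂ c₂) :=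
    dist_polar_congr (by congr 1; linarith)
  have e3 : dist (polar r₁ (c₁ - B)) (polar r₂ (c₂ - B)) = dist (polar r₁ c₁) (polar r₂ c₂) :=
    dist_polar_congr (by congr 1; linarith)
  rw [e1, e2, e3]
  refine le_antisymm ?_ (dist_triangle _ _ _)
  have t1 := dist_triangle (polar y.rad u) (polar r₁ c₁) (polar z.rad v)
  have t2 := dist_triangle (polar r₁ c₁) (polar r₂ c₂) (polar z.rad v)
  linarith

/-! ### Hyperbolic convexity of the union of the triangles -/

/-- The space glued from the four ideal triangles, before points at distance zero are identified. -/
abbrev PreGlued : Type := {x : HypCone L // S.Covers x}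

/-- Geodesics of the cone between covered points stay covered, and the inequality is then inherited
from the cone. They avoid the cone point or run through it according to whether the angle is below
π. -/
lemma hasHyperbolicConvexity_preGlued : HasHyperbolicConvexity S.PreGlued := by
  have hpi := Real.pi_pos
  have small : ∀ (y z : S.PreGlued) (u v s : ℝ), y.1.ang = u → z.1.ang = v → u ≤ v →
      v < u + Real.pi → 0 ≤ s → s ≤ dist y z → ∃ p, IsHyperbolicallyBetween y z s p := by
    intro y z u v s hy hz huv hv hs0 hs
    obtain ⟨p, w, hp, huw, hwv, hb, h1, h2, h3⟩ :=
      HypCone.exists_between_of_angle_lt S.two_pi_le hy hz huv hv hs0 hs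
    exact ⟨⟨p, y.2.of_between z.2 hy hz hp huw hwv hv hb⟩, h1, h2, fun x => h3 x⟩
  have large : ∀ (y z : S.PreGlued) (s : ℝ), Real.pi ≤ ‖z.1.ang - y.1.ang‖ → 0 ≤ s →
      s ≤ y.1.rad → ∃ p, IsHyperbolicallyBetween y z s p := by
    intro y z s h hs0 hs
    have hb := HypCone.isHyperbolicallyBetween_of_pi_le S.two_pi_le
      (p := ⟨y.1.rad - s, y.1.ang, by linarith⟩) h rfl (by simpa using hs0)
    simp only [sub_sub_cancel] at hb
    obtain ⟨h1, h2, h3⟩ := hb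
    exact ⟨⟨_, y.2.of_ang_eq (p := ⟨y.1.rad - s, y.1.ang, by linarith⟩) rfl (by simpa using hs0)⟩,
      h1, h2, fun x => h3 x⟩
  intro y z s hs0 hs
  rcases lt_or_ge ‖z.1.ang - y.1.ang‖ Real.pi with h | h
  · obtain ⟨u, hu, -⟩ := HypCone.exists_lift y.1.ang
    obtain ⟨δ, hδ, hn⟩ := HypCone.exists_lift (z.1.ang - y.1.ang)
    rw [hn, abs_lt] at h
    have hz : z.1.ang = ((u + δ : ℝ) : AddCircle L) := by
      rw [AddCircle.coe_add, hu, hδ]; abel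
    rcases le_total 0 δ with h0 | h0
    · exact small y z u (u + δ) s hu.symm hz (by linarith) (by linarith) hs0 hs
    · obtain ⟨p, hp⟩ := small z y (u + δ) u (dist y z - s) hz hu.symm (by linarith) (by linarith)
        (by linarith) (by rw [dist_comm z y]; linarith)
      exact ⟨p, hp.symm⟩
  -- A point beyond the cone point lies on the ray of `z` and is treated from there by symmetry.
  · rcases le_total s y.1.rad with h0 | h0
    · exact large y z s h hs0 h0
    · have hd : dist y z = y.1.rad + z.1.rad :=
        HypCone.dist_eq_rad_add_rad (by rwa [norm_sub_rev])
      obtain ⟨p, hp⟩ := large z y (dist y z - s) (by rwa [norm_sub_rev]) (by linarith)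
        (by linarith)
      exact ⟨p, hp.symm⟩

end CyclicSectors

/-! ### Recovering directions from distances in the cone -/

namespace HypCone

variable {L : ℝ}

lemma abs_rad_sub_rad_le (x y : HypCone L) : |x.rad - y.rad| ≤ dist x y := by
  have h := abs_dist_sub_le (polar x.rad 0) (polar y.rad (angle x y)) (polar 0 0)
  rwa [dist_comm, dist_polar_zero x.rad_nonneg, dist_comm (polar y.rad _),
    dist_polar_zero y.rad_nonneg] at h

lemma angle_eq_zero_of_cos {x y : HypCone L} (h : Real.cos (angle x y) = 1) : angle x y = 0 := by
  rw [← Real.arccos_cos (angle_nonneg x y) (angle_le_pi x y), h, Real.arccos_one]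

lemma ang_eq_of_angle_eq_zero {x y : HypCone L} (h : angle x y = 0) : x.ang = y.ang := by
  rw [angle, min_def] at h
  split_ifs at h with h1
  · exact absurd h Real.pi_pos.ne'
  · exact sub_eq_zero.1 (norm_eq_zero.1 h)

lemma dist_eq_abs_iff {x y : HypCone L} (hx : 0 < x.rad) (hy : 0 < y.rad) :
    dist x y = |x.rad - y.rad| ↔ x.ang = y.ang := by
  refine ⟨fun h => ang_eq_of_angle_eq_zero (angle_eq_zero_of_cos ?_), dist_eq_of_ang_eq⟩
  have h1 := cosh_dist x y
  rw [h, Real.cosh_abs, Real.cosh_sub] at h1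
  have h2 := mul_pos (Real.sinh_pos_iff.2 hx) (Real.sinh_pos_iff.2 hy)
  have h3 : Real.sinh x.rad * Real.sinh y.rad * Real.cos (angle x y) =
      Real.sinh x.rad * Real.sinh y.rad * 1 := by linarith
  exact mul_left_cancel₀ h2.ne' h3

lemma dist_eq_zero_of_rad {x y : HypCone L} (hx : x.rad = 0) (hy : y.rad = 0) : dist x y = 0 :=
  le_antisymm ((dist_le_rad_add_rad x y).trans (by rw [hx, hy, add_zero])) dist_nonneg

lemma eq_of_dist_eq_zero {x y : HypCone L} (h : dist x y = 0) :
    x.rad = y.rad ∧ (0 < x.rad → x.ang = y.ang) := by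
  have h1 := abs_rad_sub_rad_le x y
  rw [h] at h1
  have h2 : x.rad = y.rad := sub_eq_zero.1 (abs_eq_zero.1 (le_antisymm h1 (abs_nonneg _)))
  refine ⟨h2, fun h3 => (dist_eq_abs_iff h3 (h2 ▸ h3)).1 ?_⟩
  rw [h, h2, sub_self, abs_zero]

/-- Points with large Gromov product are seen from the cone point under a small angle. -/
lemma one_sub_cos_angle_le (x y : HypCone L) {G : ℝ} (hG : G = (x.rad + y.rad - dist x y) / 2)
    (h1 : 1 ≤ G) : 1 - Real.cos (angle x y) ≤ 16 * Real.exp (-(2 * G)) := by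
  have hab := abs_le.1 (abs_rad_sub_rad_le x y)
  have hx : 1 ≤ x.rad := by linarith
  have hy : 1 ≤ y.rad := by linarith
  -- Both radii are at least G ≥ 1; the two factors 1/4 produce the constant 16.
  have key : ∀ r : ℝ, 1 ≤ r → Real.exp r / 4 ≤ Real.sinh r := by
    intro r hr
    rw [Real.sinh_eq]
    have e1 : 2 ≤ Real.exp r := by linarith [Real.add_one_le_exp r]
    have e2 : Real.exp (-r) ≤ 1 := Real.exp_le_one_iff.2 (by linarith)
    linarith
  have hs : Real.exp x.rad / 4 * (Real.exp y.rad / 4) ≤ Real.sinh x.rad * Real.sinh y.rad :=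
    mul_le_mul (key _ hx) (key _ hy) (by positivity) (Real.sinh_nonneg_iff.2 (by linarith))
  have hc := cosh_dist x y
  have hc2 : Real.sinh x.rad * Real.sinh y.rad * (1 - Real.cos (angle x y)) ≤
      Real.exp (dist x y) := by
    have e1 := Real.cosh_sub x.rad y.rad
    have e2 := Real.cosh_pos (x.rad - y.rad)
    have e3 : Real.cosh (dist x y) ≤ Real.exp (dist x y) := by
      rw [Real.cosh_eq]
      have : Real.exp (-dist x y) ≤ Real.exp (dist x y) :=
        Real.exp_le_exp.2 (by linarith [dist_nonneg (x := x) (y := y)])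
      linarith
    linarith
  have hcos : 0 ≤ 1 - Real.cos (angle x y) := sub_nonneg.2 (Real.cos_le_one _)
  have h2 := (mul_le_mul_of_nonneg_right hs hcos).trans hc2
  have h3 : Real.exp (dist x y) = Real.exp x.rad * Real.exp y.rad * Real.exp (-(2 * G)) := by
    rw [← Real.exp_add, ← Real.exp_add, hG]
    congr 1
    ring
  rw [h3] at h2
  have h4 : 0 < Real.exp x.rad * Real.exp y.rad := by positivity
  refine le_of_mul_le_mul_left ?_ h4
  linarith

end HypCone

/-! ### Rays and the boundary at infinity -/

/-- Seen from o the Gromov product of γ m and γ n is min m n, and another base point costs at most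
its distance from o. -/
lemma IsRay.convergesToInfinity {X : Type*} [MetricSpace X] {o : X} {γ : ℝ → X}
    (h : IsRay o γ) : ConvergesToInfinity (fun n : ℕ => γ n) := by
  intro o'
  have hd : ∀ n : ℕ, (n : ℝ) - dist o o' ≤ dist o' (γ n) := by
    intro n
    have h1 := h.2 0 n le_rfl n.cast_nonneg
    rw [h.1, zero_sub, abs_neg, abs_of_nonneg (n.cast_nonneg)] at h1
    linarith [dist_triangle o o' (γ n)]
  have hlow : ∀ p : ℕ × ℕ, min (p.1 : ℝ) p.2 - dist o o' ≤ gromovProd o' (γ p.1) (γ p.2) := by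
    intro p
    rw [gromovProd, h.2 p.1 p.2 p.1.cast_nonneg p.2.cast_nonneg]
    have h1 := hd p.1
    have h2 := hd p.2
    have h3 : min (p.1 : ℝ) p.2 = ((p.1 : ℝ) + p.2 - |(p.1 : ℝ) - p.2|) / 2 := by
      rcases le_total (p.1 : ℝ) p.2 with h | h
      · rw [min_eq_left h, abs_of_nonpos (sub_nonpos.2 h)]; ring
      · rw [min_eq_right h, abs_of_nonneg (sub_nonneg.2 h)]; ring
    rw [h3]
    linarith
  refine tendsto_atTop_mono hlow (tendsto_atTop_add_const_right _ _ ?_)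
  rw [← prod_atTop_atTop_eq]
  refine tendsto_atTop.2 fun c => ?_
  filter_upwards [(tendsto_natCast_atTop_atTop.comp tendsto_fst).eventually_ge_atTop c,
    (tendsto_natCast_atTop_atTop.comp tendsto_snd).eventually_ge_atTop c] with p h1 h2
  exact le_min h1 h2

/-! ### The glued space and its charts -/

namespace CyclicSectors

variable {L : ℝ} (S : CyclicSectors L)

/-- The space glued from the four ideal triangles. -/
abbrev Glued : Type := SeparationQuotient S.PreGlued

variable {S} in
/-- The point of the glued space given by a covered point of the cone. -/
def toGlued (x : HypCone L) (h : S.Covers x) : S.Glued :=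
  SeparationQuotient.mk (⟨x, h⟩ : S.PreGlued)

lemma dist_toGlued {x y : HypCone L} (hx : S.Covers x) (hy : S.Covers y) :
    dist (toGlued x hx) (toGlued y hy) = dist x y := rfl

lemma exists_toGlued (x : S.Glued) : ∃ (y : HypCone L) (h : S.Covers y), toGlued y h = x := by
  obtain ⟨y, rfl⟩ := SeparationQuotient.surjective_mk x
  exact ⟨y.1, y.2, rfl⟩

lemma toGlued_eq_toGlued {x y : HypCone L} (hx : S.Covers x) (hy : S.Covers y) (h : dist x y = 0) :
    toGlued x hx = toGlued y hy := dist_eq_zero.1 h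

/-- The point of the cone in the `i`-th sector that corresponds to a point of the plane. -/
def chartPoint (i : Fin 4) (z : ℍ) : HypCone L :=
  ⟨polarRad z, S.start i + (polarArg z : ℝ), polarRad_nonneg z⟩

lemma covers_chartPoint {i : Fin 4} {z : ℍ} (hz : z ∈ sectorTriangle (S.angle i)) :
    S.Covers (S.chartPoint i z) :=
  ⟨i, polarArg z, polarArg_mem_of_mem_sectorTriangle (S.angle_pos i) (S.angle_le_pi i) hz, rfl,
    by rwa [chartPoint, polar_polarRad_polarArg]⟩

lemma covers_ray (i : Fin 4) {t : ℝ} (ht : 0 ≤ t) : S.Covers ⟨t, S.start i, ht⟩ :=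
  ⟨i, 0, ⟨le_rfl, (S.angle_pos i).le⟩, by simp, polar_zero_mem_sectorTriangle ht _⟩

/-- The cone point. -/
def apex : S.Glued := toGlued ⟨0, S.start 0, le_rfl⟩ (S.covers_ray 0 le_rfl)

open Classical in
/-- The embedding of the `i`-th ideal triangle. -/
def chart (i : Fin 4) (z : ℍ) : S.Glued :=
  if h : z ∈ sectorTriangle (S.angle i) then toGlued (S.chartPoint i z) (S.covers_chartPoint h)
  -- Default value; the gluing conditions constrain `chart` only on the triangle.
  else S.apex

/-- The common ray of the triangles `i - 1` and `i`. -/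
def ray (i : Fin 4) (t : ℝ) : S.Glued := S.chart i (polar t 0)

lemma chart_eq {i : Fin 4} {z : ℍ} (hz : z ∈ sectorTriangle (S.angle i)) :
    S.chart i z = toGlued (S.chartPoint i z) (S.covers_chartPoint hz) := dif_pos hz

lemma dist_chart {i : Fin 4} {z w : ℍ} (hz : z ∈ sectorTriangle (S.angle i))
    (hw : w ∈ sectorTriangle (S.angle i)) : dist (S.chart i z) (S.chart i w) = dist z w := by
  have h1 := polarArg_mem_of_mem_sectorTriangle (S.angle_pos i) (S.angle_le_pi i) hz
  have h2 := polarArg_mem_of_mem_sectorTriangle (S.angle_pos i) (S.angle_le_pi i) hw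
  have h3 := S.angle_le_pi i
  have h4 : |polarArg z - polarArg w| ≤ Real.pi :=
    abs_le.2 ⟨by linarith [h1.1, h2.2], by linarith [h1.2, h2.1]⟩
  rw [S.chart_eq hz, S.chart_eq hw, dist_toGlued,
    HypCone.dist_eq_of_cos (φ := polarArg z) (ψ := polarArg w)]
  · simp only [chartPoint, polar_polarRad_polarArg]
  · rw [HypCone.angle, chartPoint, chartPoint, add_sub_add_left_eq_sub, ← AddCircle.coe_sub,
      HypCone.norm_coe_eq S.two_pi_le h4, min_eq_right h4, Real.cos_abs]

/-- At radius 0 the angular coordinate is lost, but all points of radius 0 are identified in the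
quotient. -/
lemma chart_polar {i : Fin 4} {x : HypCone L} (hx : S.Covers x) {φ : ℝ}
    (hφ : φ ∈ Set.Icc 0 (S.angle i)) (ha : x.ang = S.start i + (φ : ℝ)) :
    S.chart i (polar x.rad φ) = toGlued x hx := by
  rw [S.chart_eq (hx.polar_mem hφ ha)]
  refine S.toGlued_eq_toGlued _ _ ?_
  rcases x.rad_nonneg.eq_or_lt with h | h
  · exact HypCone.dist_eq_zero_of_rad (polarRad_polar x.rad_nonneg φ |>.trans h.symm) h.symm
  · rw [HypCone.dist_eq_of_ang_eq]
    · simp [chartPoint, polarRad_polar x.rad_nonneg]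
    · rw [chartPoint, polarArg_polar h hφ.1 (hφ.2.trans (S.angle_le_pi i)), ha]

lemma ray_eq (i : Fin 4) {t : ℝ} (ht : 0 ≤ t) :
    S.ray i t = toGlued ⟨t, S.start i, ht⟩ (S.covers_ray i ht) :=
  S.chart_polar (x := ⟨t, S.start i, ht⟩) (S.covers_ray i ht)
    ⟨le_rfl, (S.angle_pos i).le⟩ (by simp)

lemma chart_polar_angle (i : Fin 4) {t : ℝ} (ht : 0 ≤ t) :
    S.chart i (polar t (S.angle i)) = S.ray (i + 1) t := by
  rw [S.ray_eq _ ht]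
  exact S.chart_polar (x := ⟨t, S.start (i + 1), ht⟩) (S.covers_ray (i + 1) ht)
    ⟨(S.angle_pos i).le, le_rfl⟩ (S.start_succ i)

lemma toGlued_eq_apex {x : HypCone L} (hx : S.Covers x) (h : x.rad = 0) : toGlued x hx = S.apex :=
  S.toGlued_eq_toGlued _ _ (HypCone.dist_eq_zero_of_rad h rfl)

lemma ray_zero (i : Fin 4) : S.ray i 0 = S.apex := by
  rw [S.ray_eq i le_rfl, S.toGlued_eq_apex _ rfl]

lemma isRay_ray (i : Fin 4) : IsRay S.apex (S.ray i) := by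
  refine ⟨S.ray_zero i, fun s t hs ht => ?_⟩
  rw [S.ray_eq i hs, S.ray_eq i ht, dist_toGlued]
  exact HypCone.dist_eq_of_ang_eq rfl

lemma dist_apex_toGlued {x : HypCone L} (hx : S.Covers x) : dist S.apex (toGlued x hx) = x.rad := by
  rw [apex, dist_toGlued]
  refine le_antisymm ((HypCone.dist_le_rad_add_rad _ _).trans (by simp)) ?_
  refine le_trans ?_ (HypCone.abs_rad_sub_rad_le _ _)
  rw [zero_sub, abs_neg]
  exact le_abs_self _

lemma eq_of_chart_eq {i j : Fin 4} {z w : ℍ} (hz : z ∈ sectorTriangle (S.angle i))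
    (hw : w ∈ sectorTriangle (S.angle j)) (h : S.chart i z = S.chart j w) :
    S.chart i z = S.apex ∨
      S.start i + (polarArg z : AddCircle L) = S.start j + (polarArg w : ℝ) := by
  rw [S.chart_eq hz, S.chart_eq hw] at h
  have h1 := HypCone.eq_of_dist_eq_zero (x := S.chartPoint i z) (y := S.chartPoint j w)
    (by rw [← S.dist_toGlued (S.covers_chartPoint hz) (S.covers_chartPoint hw), h, dist_self])
  rcases (S.chartPoint i z).rad_nonneg.eq_or_lt with h0 | h0
  · left
    rw [S.chart_eq hz, S.toGlued_eq_apex _ h0.symm]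
  · exact Or.inr (h1.2 h0)

lemma iUnion_chart : ⋃ i, S.chart i '' sectorTriangle (S.angle i) = Set.univ := by
  refine Set.eq_univ_of_forall fun x => ?_
  obtain ⟨y, hy, rfl⟩ := S.exists_toGlued x
  obtain ⟨i, φ, hφ, ha, hmem⟩ := id hy
  exact Set.mem_iUnion.2 ⟨i, _, hmem, S.chart_polar hy hφ ha⟩

lemma chart_inter_succ (i : Fin 4) :
    S.chart i '' sectorTriangle (S.angle i) ∩ S.chart (i + 1) '' sectorTriangle (S.angle (i + 1)) =
      S.ray (i + 1) '' Set.Ici 0 := by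
  apply Set.Subset.antisymm
  · rintro p ⟨⟨z, hz, rfl⟩, w, hw, hwz⟩
    rcases S.eq_of_chart_eq hz hw hwz.symm with h | h
    · exact ⟨0, Set.mem_Ici.2 le_rfl, by rw [S.ray_zero, h]⟩
    · have h1 := (S.start_add_succ_eq
        (polarArg_mem_of_mem_sectorTriangle (S.angle_pos i) (S.angle_le_pi i) hz)
        (polarArg_mem_of_mem_sectorTriangle (S.angle_pos _) (S.angle_le_pi _) hw) h).2
      refine ⟨polarRad w, polarRad_nonneg w, ?_⟩
      rw [← hwz, ray, ← h1, polar_polarRad_polarArg]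
  · rintro _ ⟨t, ht, rfl⟩
    exact ⟨⟨_, polar_mem_sectorTriangle ht _, S.chart_polar_angle i ht⟩,
      _, polar_zero_mem_sectorTriangle ht _, rfl⟩

lemma chart_apex (i : Fin 4) : S.chart i (polar 0 0) = S.apex := S.ray_zero i

lemma chart_inter_add_two (i : Fin 4) :
    S.chart i '' sectorTriangle (S.angle i) ∩ S.chart (i + 2) '' sectorTriangle (S.angle (i + 2)) =
      {S.apex} := by
  apply Set.Subset.antisymm
  · rintro p ⟨⟨z, hz, rfl⟩, w, hw, hwz⟩
    rcases S.eq_of_chart_eq hz hw hwz.symm with h | h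
    · exact h
    · exact absurd h (S.not_start_add_two_eq
        (polarArg_mem_of_mem_sectorTriangle (S.angle_pos i) (S.angle_le_pi i) hz)
        (polarArg_mem_of_mem_sectorTriangle (S.angle_pos _) (S.angle_le_pi _) hw))
  · rintro _ rfl
    exact ⟨⟨_, polar_zero_mem_sectorTriangle le_rfl _, S.chart_apex i⟩,
      _, polar_zero_mem_sectorTriangle le_rfl _, S.chart_apex _⟩

lemma compAngle_eq {t θ d : ℝ} (ht : 0 < t) (h0 : 0 ≤ θ) (hpi : θ ≤ Real.pi)
    (hd : Real.cosh d = Real.cosh t * Real.cosh t - Real.sinh t * Real.sinh t * Real.cos θ) :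
    compAngle t t d = θ := by
  have hs := Real.sinh_pos_iff.2 ht
  rw [compAngle, hd, sub_sub_cancel, mul_div_cancel_left₀ _ (mul_pos hs hs).ne',
    Real.arccos_cos h0 hpi]

lemma isCyclicGluing : IsCyclicGluing S.apex S.ray S.angle := by
  refine ⟨fun _ => polar 0 0, fun _ t => polar t 0, fun i t => polar t (S.angle i), S.chart,
    fun i => ⟨isRay_polar _, isRay_polar _⟩, fun i t ht => ?_,
    fun i x hx y hy => S.dist_chart hx hy, S.chart_apex,
    fun i t ht => ⟨rfl, S.chart_polar_angle i ht⟩, S.chart_inter_succ, S.chart_inter_add_two,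
    S.iUnion_chart⟩
  refine compAngle_eq ht (S.angle_pos i).le (S.angle_le_pi i) ?_
  rw [cosh_dist_polar, zero_sub, Real.cos_neg]

/-- A finite union of isometric images of closed subsets of the complete hyperbolic plane. -/
lemma completeSpace_glued : CompleteSpace S.Glued := by
  have h : ∀ i, IsComplete (S.chart i '' sectorTriangle (S.angle i)) := by
    intro i
    have hc : IsComplete (sectorTriangle (S.angle i)) := (isClosed_idealTriangle _ _).isComplete
    have : CompleteSpace (sectorTriangle (S.angle i)) := completeSpace_coe_iff_isComplete.2 hc
    have hi : Isometry fun z : sectorTriangle (S.angle i) => S.chart i z :=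
      Isometry.of_dist_eq fun z w => S.dist_chart z.2 w.2
    have := hi.isUniformInducing.isComplete_range
    rwa [Set.image_eq_range]
  refine completeSpace_of_isComplete_univ ?_
  have hu : (Set.univ : Set S.Glued) = S.chart 0 '' sectorTriangle (S.angle 0) ∪
      (S.chart 1 '' sectorTriangle (S.angle 1) ∪ (S.chart 2 '' sectorTriangle (S.angle 2) ∪
        S.chart 3 '' sectorTriangle (S.angle 3))) := by
    rw [← S.iUnion_chart]
    ext x
    simp [Fin.exists_fin_succ]
  rw [hu]
  exact (h 0).union ((h 1).union ((h 2).union (h 3)))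

lemma isCATNegOne_glued : IsCATNegOne S.Glued :=
  S.hasHyperbolicConvexity_preGlued.separationQuotient.isCATNegOne S.completeSpace_glued

/-! ### Directions of boundary points and uniqueness of rays -/

/-- Polar coordinates of a point of the glued space. -/
def rep (x : S.Glued) : HypCone L := (S.exists_toGlued x).choose

lemma covers_rep (x : S.Glued) : S.Covers (S.rep x) := (S.exists_toGlued x).choose_spec.choose

lemma toGlued_rep (x : S.Glued) : toGlued (S.rep x) (S.covers_rep x) = x :=
  (S.exists_toGlued x).choose_spec.choose_spec

lemma dist_rep (x y : S.Glued) : dist (S.rep x) (S.rep y) = dist x y := by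
  rw [← S.dist_toGlued (S.covers_rep x) (S.covers_rep y), toGlued_rep, toGlued_rep]

lemma rad_rep (x : S.Glued) : (S.rep x).rad = dist S.apex x := by
  rw [← S.dist_apex_toGlued (S.covers_rep x), toGlued_rep]

/-- The sequences are asymptotically seen from the cone point in the same direction. -/
def SameDirection (x x' : ℕ → S.Glued) : Prop :=
  Tendsto (fun n => HypCone.angle (S.rep (x n)) (S.rep (x' n))) atTop (𝓝 0)

lemma angle_le_add (x y z : HypCone L) :
    HypCone.angle x z ≤ HypCone.angle x y + HypCone.angle y z :=
  (HypCone.angle_triangle x y z).trans (min_le_right _ _)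

lemma equivalence_sameDirection :
    Equivalence fun x x' : {x : ℕ → S.Glued // ConvergesToInfinity x} =>
      S.SameDirection x.1 x'.1 where
  refl x := by simp [SameDirection, HypCone.angle, Real.pi_pos.le]
  symm {x y} h := by simpa only [SameDirection, HypCone.angle_comm] using h
  trans {x y z} h h' := by
    have h2 := Tendsto.add h h'
    rw [add_zero] at h2
    exact squeeze_zero (fun n => HypCone.angle_nonneg _ _) (fun n => angle_le_add _ _ _) h2

lemma sameDirection_of_equivAtInfinity {x x' : {x : ℕ → S.Glued // ConvergesToInfinity x}}
    (h : EquivAtInfinity x x') : S.SameDirection x.1 x'.1 := by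
  have h1 := h S.apex
  have h2 : Tendsto (fun n => Real.cos (HypCone.angle (S.rep (x.1 n)) (S.rep (x'.1 n)))) atTop
      (𝓝 1) := by
    have h3 : Tendsto (fun n => 1 - 16 * Real.exp (-(2 * gromovProd S.apex (x.1 n) (x'.1 n))))
        atTop (𝓝 (1 - 16 * 0)) :=
      tendsto_const_nhds.sub (tendsto_const_nhds.mul
        (Real.tendsto_exp_neg_atTop_nhds_zero.comp (h1.const_mul_atTop two_pos)))
    rw [mul_zero, sub_zero] at h3
    refine tendsto_of_tendsto_of_tendsto_of_le_of_le' h3 tendsto_const_nhds ?_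
      (Eventually.of_forall fun n => Real.cos_le_one _)
    filter_upwards [h1.eventually_ge_atTop 1] with n hn
    have := HypCone.one_sub_cos_angle_le (S.rep (x.1 n)) (S.rep (x'.1 n))
      (G := gromovProd S.apex (x.1 n) (x'.1 n))
      (by rw [gromovProd, S.rad_rep, S.rad_rep, S.dist_rep]) hn
    linarith
  have h4 := (Real.continuous_arccos.tendsto 1).comp h2
  rw [Real.arccos_one] at h4
  refine h4.congr fun n => ?_
  exact Real.arccos_cos (HypCone.angle_nonneg _ _) (HypCone.angle_le_pi _ _)

/-- Equality in `Quot` is the equivalence generated by `EquivAtInfinity`. Since `SameDirection` is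
itself an equivalence relation, it suffices to treat the generators. -/
lemma sameDirection_of_mk_eq {x x' : {x : ℕ → S.Glued // ConvergesToInfinity x}}
    (h : (Quot.mk EquivAtInfinity x : Boundary S.Glued) = Quot.mk EquivAtInfinity x') :
    S.SameDirection x.1 x'.1 :=
  S.equivalence_sameDirection.eqvGen_iff.1
    (Relation.EqvGen.mono (fun _ _ => S.sameDirection_of_equivAtInfinity) _ _
      (Quot.eqvGen_exact h))

/-- The ideal vertex at which the `i`-th ray ends. -/
def endpoint (i : Fin 4) : Boundary S.Glued :=
  Quot.mk _ ⟨fun n : ℕ => S.ray i n, (S.isRay_ray i).convergesToInfinity⟩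

lemma isRayTo_ray (i : Fin 4) : IsRayTo S.apex (S.endpoint i) (S.ray i) :=
  ⟨S.isRay_ray i, (S.isRay_ray i).convergesToInfinity, rfl⟩

lemma angle_rep_of_isRay {γ : ℝ → S.Glued} (h : IsRay S.apex γ) {s t : ℝ} (hs : 0 < s)
    (ht : 0 < t) : HypCone.angle (S.rep (γ s)) (S.rep (γ t)) = 0 := by
  have hr : ∀ t, 0 < t → (S.rep (γ t)).rad = t := by
    intro t ht
    rw [S.rad_rep, ← h.1, h.2 0 t le_rfl ht.le, zero_sub, abs_neg, abs_of_pos ht]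
  have h1 := (HypCone.dist_eq_abs_iff (x := S.rep (γ s)) (y := S.rep (γ t))
    (by rwa [hr s hs]) (by rwa [hr t ht])).1
    (by rw [S.dist_rep, hr s hs, hr t ht, h.2 s t hs.le ht.le])
  rw [HypCone.angle, h1, sub_self, norm_zero, min_eq_right Real.pi_pos.le]

lemma eq_ray_of_isRayTo {i : Fin 4} {γ : ℝ → S.Glued} (h : IsRayTo S.apex (S.endpoint i) γ)
    {t : ℝ} (ht : 0 ≤ t) : γ t = S.ray i t := by
  obtain ⟨hγ, hc, he⟩ := h
  rcases ht.eq_or_lt with rfl | ht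
  · rw [hγ.1, S.ray_zero]
  have h1 := S.sameDirection_of_mk_eq he
  simp only [SameDirection] at h1
  -- Both rays have constant direction, so the angle at time t is at most the angle at every time n
  -- > 0, which tends to 0.
  have h2 : HypCone.angle (S.rep (γ t)) (S.rep (S.ray i t)) ≤ 0 := by
    refine ge_of_tendsto h1 ?_
    filter_upwards [eventually_gt_atTop 0] with n hn
    have hn' : (0 : ℝ) < n := Nat.cast_pos.2 hn
    have a1 := angle_le_add (S.rep (γ t)) (S.rep (γ n)) (S.rep (S.ray i t))
    have a2 := angle_le_add (S.rep (γ n)) (S.rep (S.ray i n)) (S.rep (S.ray i t))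
    rw [S.angle_rep_of_isRay hγ ht hn'] at a1
    rw [S.angle_rep_of_isRay (S.isRay_ray i) hn' ht] at a2
    linarith
  have h3 := HypCone.ang_eq_of_angle_eq_zero (le_antisymm h2 (HypCone.angle_nonneg _ _))
  have h4 := HypCone.dist_eq_of_ang_eq h3
  have hr : ∀ η : ℝ → S.Glued, IsRay S.apex η → dist S.apex (η t) = t := by
    intro η hη
    rw [← hη.1, hη.2 0 t le_rfl ht.le, zero_sub, abs_neg, abs_of_pos ht]
  rw [S.dist_rep, S.rad_rep, S.rad_rep, hr γ hγ, hr _ (S.isRay_ray i), sub_self, abs_zero] at h4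
  exact dist_eq_zero.1 h4

/-- `rayTo` picks some ray to the boundary point; uniqueness makes the choice immaterial for t ≥ 0.
-/
lemma rayTo_endpoint (i : Fin 4) {t : ℝ} (ht : 0 ≤ t) :
    rayTo S.apex (S.endpoint i) t = S.ray i t := by
  refine S.eq_ray_of_isRayTo ?_ ht
  exact Classical.epsilon_spec_aux _ _ ⟨_, S.isRayTo_ray i⟩

/-! ### The Bourdon metric on the ideal vertices -/

/-- The comparison angle is constant for t > 0, because the cone metric is the law of cosines with
this very angle. -/
lemma asymptoticAngle_endpoint (i j : Fin 4) :
    asymptoticAngle S.apex (S.endpoint i) (S.endpoint j) =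
      min Real.pi ‖S.start i - S.start j‖ := by
  refine Tendsto.limUnder_eq (tendsto_const_nhds.congr' ?_)
  filter_upwards [eventually_gt_atTop 0] with t ht
  rw [S.rayTo_endpoint i ht.le, S.rayTo_endpoint j ht.le]
  symm
  refine compAngle_eq ht (le_min Real.pi_pos.le (norm_nonneg _)) (min_le_left _ _) ?_
  rw [S.ray_eq i ht.le, S.ray_eq j ht.le, dist_toGlued, HypCone.cosh_dist]
  rfl

lemma bourdon_self (i : Fin 4) : bourdon S.apex (S.endpoint i) (S.endpoint i) = 0 := by
  rw [bourdon, asymptoticAngle_endpoint, sub_self, norm_zero, min_eq_right Real.pi_pos.le]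
  simp

lemma bourdon_comm (i j : Fin 4) : bourdon S.apex (S.endpoint i) (S.endpoint j) =
    bourdon S.apex (S.endpoint j) (S.endpoint i) := by
  rw [bourdon, bourdon, asymptoticAngle_endpoint, asymptoticAngle_endpoint, norm_sub_rev]

lemma bourdon_succ (i : Fin 4) :
    bourdon S.apex (S.endpoint i) (S.endpoint (i + 1)) = Real.sin (S.angle i / 2) := by
  have h : |S.angle i| ≤ Real.pi := by rw [abs_of_pos (S.angle_pos i)]; exact S.angle_le_pi i
  rw [bourdon, asymptoticAngle_endpoint, S.start_succ, sub_add_cancel_left, norm_neg,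
    HypCone.norm_coe_eq S.two_pi_le h, min_eq_right h, abs_of_pos (S.angle_pos i)]

lemma bourdon_add_two (i : Fin 4) : bourdon S.apex (S.endpoint i) (S.endpoint (i + 2)) = 1 := by
  have h := S.two_pi_le
  have hL := S.length_pos
  rw [bourdon, asymptoticAngle_endpoint, S.start_add_two, sub_add_cancel_left, norm_neg,
    AddCircle.norm_half_period_eq, abs_of_pos hL, min_eq_left (by linarith), Real.sin_pi_div_two]

end CyclicSectors

/-! ### Metrics on four points -/

lemma fin_four_cases : ∀ i : Fin 4, i = 0 ∨ i = 1 ∨ i = 2 ∨ i = 3 := by decide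

lemma exists_complement : ∀ i j : Fin 4, i ≠ j →
    ∃ k l : Fin 4, i ≠ k ∧ i ≠ l ∧ j ≠ k ∧ j ≠ l ∧ k ≠ l := by decide

/-- Products over perfect matchings of four points are determined by three of them. -/
lemma matching_products {M D : Fin 4 → Fin 4 → ℝ} {C : ℝ} (hM : ∀ i j, M i j = M j i)
    (hD : ∀ i j, D i j = D j i) (h1 : M 0 1 * M 2 3 = D 0 1 * D 2 3 / C)
    (h2 : M 1 2 * M 3 0 = D 1 2 * D 3 0 / C) (h3 : M 0 2 * M 1 3 = D 0 2 * D 1 3 / C)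
    {i j k l : Fin 4} (hij : i ≠ j) (hik : i ≠ k) (hil : i ≠ l) (hjk : j ≠ k) (hjl : j ≠ l)
    (hkl : k ≠ l) : M i j * M k l = D i j * D k l / C := by
  rcases fin_four_cases i with rfl | rfl | rfl | rfl <;>
  rcases fin_four_cases j with rfl | rfl | rfl | rfl <;>
  first
  | exact absurd rfl hij
  | rcases fin_four_cases k with rfl | rfl | rfl | rfl <;>
    first
    | exact absurd rfl hik
    | exact absurd rfl hjk
    | rcases fin_four_cases l with rfl | rfl | rfl | rfl <;>
      first
      | exact absurd rfl hil
      | exact absurd rfl hjl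
      | exact absurd rfl hkl
      | (try simp only [hM 1 0, hM 2 0, hM 0 3, hM 2 1, hM 3 1, hM 3 2,
          hD 1 0, hD 2 0, hD 0 3, hD 2 1, hD 3 1, hD 3 2]
         first
         | linear_combination h1
         | linear_combination h2
         | linear_combination h3)

/-- Four points can be enumerated such that the product over the diagonals is maximal. -/
lemma exists_enumeration {W : Type*} [MetricSpace W] (hcard : Nat.card W = 4) :
    ∃ w : Fin 4 ≃ W,
      dist (w 0) (w 1) * dist (w 2) (w 3) ≤ dist (w 0) (w 2) * dist (w 1) (w 3) ∧
      dist (w 1) (w 2) * dist (w 3) (w 0) ≤ dist (w 0) (w 2) * dist (w 1) (w 3) := by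
  have : Finite W := Nat.finite_of_card_ne_zero (by rw [hcard]; norm_num)
  obtain ⟨e⟩ : Nonempty (Fin 4 ≃ W) := ⟨(Finite.equivFinOfCardEq hcard).symm⟩
  have e1 := dist_comm (e 1) (e 0)
  have e2 := dist_comm (e 2) (e 1)
  have e3 := dist_comm (e 3) (e 0)
  have s1 : (Equiv.swap (1 : Fin 4) 2) 0 = 0 ∧ (Equiv.swap (1 : Fin 4) 2) 1 = 2 ∧
    (Equiv.swap (1 : Fin 4) 2) 2 = 1 ∧ (Equiv.swap (1 : Fin 4) 2) 3 = 3 := by decide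
  have s2 : (Equiv.swap (0 : Fin 4) 1) 0 = 1 ∧ (Equiv.swap (0 : Fin 4) 1) 1 = 0 ∧
    (Equiv.swap (0 : Fin 4) 1) 2 = 2 ∧ (Equiv.swap (0 : Fin 4) 1) 3 = 3 := by decide
  rcases le_total (dist (e 0) (e 1) * dist (e 2) (e 3)) (dist (e 0) (e 2) * dist (e 1) (e 3))
    with hAC | hAC <;>
  rcases le_total (dist (e 1) (e 2) * dist (e 3) (e 0)) (dist (e 0) (e 2) * dist (e 1) (e 3))
    with hBC | hBC <;>
  rcases le_total (dist (e 0) (e 1) * dist (e 2) (e 3)) (dist (e 1) (e 2) * dist (e 3) (e 0))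
    with hAB | hAB <;>
  -- If e itself fails, exchanging 1 and 2 makes 01|23 the diagonal matching, and exchanging 0 and 1
  -- makes 12|30 the diagonal matching.
  first
  | exact ⟨e, by linarith, by linarith⟩
  | (refine ⟨(Equiv.swap 1 2).trans e, ?_⟩
     simp only [Equiv.trans_apply, s1]
     rw [e2, e3] at *
     constructor <;> linarith)
  | (refine ⟨(Equiv.swap 0 1).trans e, ?_⟩
     simp only [Equiv.trans_apply, s2]
     rw [e1, dist_comm (e 3) (e 1)]
     rw [e3] at *
     constructor <;> linarith)

/-- The sectors with angles `α`, `β`, `α`, `β`. -/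
def alternatingSectors (α β : ℝ) (hα : 0 < α) (hα' : α ≤ Real.pi) (hβ : 0 < β)
    (hβ' : β ≤ Real.pi) (h : Real.pi ≤ α + β) : CyclicSectors (2 * (α + β)) where
  angle := ![α, β, α, β]
  start := fun i => ((![0, α, α + β, α + β + α] i : ℝ) : AddCircle (2 * (α + β)))
  angle_pos i := by rcases fin_four_cases i with rfl | rfl | rfl | rfl <;> simpa
  angle_le_pi i := by rcases fin_four_cases i with rfl | rfl | rfl | rfl <;> simpa
  start_succ i := by
    rcases fin_four_cases i with rfl | rfl | rfl | rfl
    · simp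
    · simp
    · simp
    · change ((0 : ℝ) : AddCircle (2 * (α + β))) = ((α + β + α : ℝ) : AddCircle (2 * (α + β))) +
        ((β : ℝ) : AddCircle (2 * (α + β)))
      rw [← AddCircle.coe_add, show α + β + α + β = 2 * (α + β) by ring, AddCircle.coe_period,
        AddCircle.coe_zero]
  angle_add i := by
    rw [mul_div_cancel_left₀ _ two_ne_zero]
    rcases fin_four_cases i with rfl | rfl | rfl | rfl
    · rfl
    · exact add_comm _ _
    · rfl
    · exact add_comm _ _
  two_pi_le := by linarith

/-- The hypothesis says that sin (arcsin a) ≥ cos (arcsin b) = sin (π/2 - arcsin b), and sine is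
increasing there. -/
lemma pi_le_two_arcsin_add {a b : ℝ} (ha : 0 ≤ a) (hb : 0 ≤ b) (ha1 : a ≤ 1)
    (h : 1 ≤ a ^ 2 + b ^ 2) : Real.pi ≤ 2 * Real.arcsin a + 2 * Real.arcsin b := by
  have h1 : Real.sin (Real.pi / 2 - Real.arcsin b) ≤ Real.sin (Real.arcsin a) := by
    rw [Real.sin_pi_div_two_sub, Real.cos_arcsin, Real.sin_arcsin (by linarith) ha1]
    exact Real.sqrt_le_iff.2 ⟨ha, by linarith⟩
  have h2 := (Real.strictMonoOn_sin.le_iff_le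
    ⟨by linarith [Real.arcsin_le_pi_div_two b, Real.pi_pos],
      by linarith [Real.arcsin_nonneg.2 hb]⟩
    ⟨Real.neg_pi_div_two_le_arcsin a, Real.arcsin_le_pi_div_two a⟩).1 h1
  linarith

end

end PtolemyCAT

/-! ### The main theorem -/

open PtolemyCAT
theorem mainTheorem6 {W : Type*} [MetricSpace W] (hcard : Nat.card W = 4) (hW : IsPtolemy W) :
    ∃ (X : Type) (_ : MetricSpace X) (o : X) (f : W → Boundary X),
      IsCATNegOne X ∧
      IsMoebiusEmbedding (fun u v : W => dist u v) (bourdon o) f ∧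
      ∃ (w : Fin 4 ≃ W) (a b α β : ℝ),
        a = √(dist (w 0) (w 1) * dist (w 2) (w 3)) / √(dist (w 0) (w 2) * dist (w 1) (w 3)) ∧
        b = √(dist (w 1) (w 2) * dist (w 3) (w 0)) / √(dist (w 0) (w 2) * dist (w 1) (w 3)) ∧
        a ≤ 1 ∧ b ≤ 1 ∧
        bourdon o (f (w 0)) (f (w 1)) = a ∧ bourdon o (f (w 2)) (f (w 3)) = a ∧
        bourdon o (f (w 1)) (f (w 2)) = b ∧ bourdon o (f (w 3)) (f (w 0)) = b ∧
        bourdon o (f (w 0)) (f (w 2)) = 1 ∧ bourdon o (f (w 1)) (f (w 3)) = 1 ∧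
        0 < α ∧ α ≤ Real.pi ∧ Real.sin (α / 2) = a ∧
        0 < β ∧ β ≤ Real.pi ∧ Real.sin (β / 2) = b ∧
        2 * Real.pi ≤ 2 * (α + β) ∧
        ∃ η : Fin 4 → ℝ → X,
          (∀ i, IsRayTo o (f (w i)) (η i)) ∧
          IsCyclicGluing o η ![α, β, α, β] := by
  obtain ⟨w, hAC, hBC⟩ := exists_enumeration hcard
  have hpos : ∀ i j, i ≠ j → 0 < dist (w i) (w j) := fun i j h => dist_pos.2 (w.injective.ne h)
  have hA := mul_pos (hpos 0 1 (by decide)) (hpos 2 3 (by decide))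
  have hB := mul_pos (hpos 1 2 (by decide)) (hpos 3 0 (by decide))
  have hC := mul_pos (hpos 0 2 (by decide)) (hpos 1 3 (by decide))
  obtain ⟨a, ha⟩ : ∃ a, a = √(dist (w 0) (w 1) * dist (w 2) (w 3)) /
    √(dist (w 0) (w 2) * dist (w 1) (w 3)) := ⟨_, rfl⟩
  obtain ⟨b, hb⟩ : ∃ b, b = √(dist (w 1) (w 2) * dist (w 3) (w 0)) /
    √(dist (w 0) (w 2) * dist (w 1) (w 3)) := ⟨_, rfl⟩
  have hCs := Real.sqrt_pos.2 hC
  have ha0 : 0 < a := ha ▸ div_pos (Real.sqrt_pos.2 hA) hCs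
  have hb0 : 0 < b := hb ▸ div_pos (Real.sqrt_pos.2 hB) hCs
  have ha1 : a ≤ 1 := ha ▸ (div_le_one hCs).2 (Real.sqrt_le_sqrt hAC)
  have hb1 : b ≤ 1 := hb ▸ (div_le_one hCs).2 (Real.sqrt_le_sqrt hBC)
  have ha2 : a ^ 2 = dist (w 0) (w 1) * dist (w 2) (w 3) /
      (dist (w 0) (w 2) * dist (w 1) (w 3)) := by
    rw [ha, div_pow, Real.sq_sqrt hA.le, Real.sq_sqrt hC.le]
  have hb2 : b ^ 2 = dist (w 1) (w 2) * dist (w 3) (w 0) /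
      (dist (w 0) (w 2) * dist (w 1) (w 3)) := by
    rw [hb, div_pow, Real.sq_sqrt hB.le, Real.sq_sqrt hC.le]
  -- The only use of the Ptolemy inequality; it makes the total angle at least 2π.
  have hab : 1 ≤ a ^ 2 + b ^ 2 := by
    rw [ha2, hb2, ← add_div, one_le_div hC]
    exact hW _ _ _ _
  have hα : 0 < 2 * Real.arcsin a := by linarith [Real.arcsin_pos.2 ha0]
  have hβ : 0 < 2 * Real.arcsin b := by linarith [Real.arcsin_pos.2 hb0]
  have hα' : 2 * Real.arcsin a ≤ Real.pi := by linarith [Real.arcsin_le_pi_div_two a]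
  have hβ' : 2 * Real.arcsin b ≤ Real.pi := by linarith [Real.arcsin_le_pi_div_two b]
  have hαa : Real.sin (2 * Real.arcsin a / 2) = a := by
    rw [mul_div_cancel_left₀ _ two_ne_zero, Real.sin_arcsin (by linarith) ha1]
  have hβb : Real.sin (2 * Real.arcsin b / 2) = b := by
    rw [mul_div_cancel_left₀ _ two_ne_zero, Real.sin_arcsin (by linarith) hb1]
  have hαβ := pi_le_two_arcsin_add ha0.le hb0.le ha1 hab
  generalize 2 * Real.arcsin a = α at *
  generalize 2 * Real.arcsin b = β at *
  obtain ⟨S, hS⟩ : ∃ S, S = alternatingSectors α β hα hα' hβ hβ' hαβ := ⟨_, rfl⟩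
  have hSα : S.angle = ![α, β, α, β] := by rw [hS]; rfl
  have h01 : bourdon S.apex (S.endpoint 0) (S.endpoint 1) = a := by
    rw [← hαa]
    exact (S.bourdon_succ 0).trans (by rw [hSα]; rfl)
  have h12 : bourdon S.apex (S.endpoint 1) (S.endpoint 2) = b := by
    rw [← hβb]
    exact (S.bourdon_succ 1).trans (by rw [hSα]; rfl)
  have h23 : bourdon S.apex (S.endpoint 2) (S.endpoint 3) = a := by
    rw [← hαa]
    exact (S.bourdon_succ 2).trans (by rw [hSα]; rfl)
  have h30 : bourdon S.apex (S.endpoint 3) (S.endpoint 0) = b := by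
    rw [← hβb]
    exact (S.bourdon_succ 3).trans (by rw [hSα]; rfl)
  have h02 : bourdon S.apex (S.endpoint 0) (S.endpoint 2) = 1 := S.bourdon_add_two 0
  have h13 : bourdon S.apex (S.endpoint 1) (S.endpoint 3) = 1 := S.bourdon_add_two 1
  -- All matching products are divided by the same diagonal product, which cancels in cross ratios.
  have hprod : ∀ {i j k l : Fin 4}, i ≠ j → i ≠ k → i ≠ l → j ≠ k → j ≠ l → k ≠ l →
      bourdon S.apex (S.endpoint i) (S.endpoint j) * bourdon S.apex (S.endpoint k) (S.endpoint l) =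
        dist (w i) (w j) * dist (w k) (w l) / (dist (w 0) (w 2) * dist (w 1) (w 3)) :=
    matching_products (M := fun i j => bourdon S.apex (S.endpoint i) (S.endpoint j))
      (D := fun i j => dist (w i) (w j)) S.bourdon_comm (fun _ _ => dist_comm _ _)
      (by simp only [h01, h23, ← ha2, sq]) (by simp only [h12, h30, ← hb2, sq])
      (by simp only [h02, h13, mul_one, div_self hC.ne'])
  refine ⟨S.Glued, inferInstance, S.apex, fun u => S.endpoint (w.symm u), S.isCATNegOne_glued,
    ⟨?_, ?_⟩, w, a, b, α, β, ha, hb, ha1, hb1, ?_⟩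
  -- Each pair extends to a perfect matching with nonzero product, so distinct indices have nonzero
  -- Bourdon distance.
  · have hne : ∀ i j, i ≠ j → bourdon S.apex (S.endpoint i) (S.endpoint j) ≠ 0 := by
      intro i j hij
      obtain ⟨k, l, hik, hil, hjk, hjl, hkl⟩ := exists_complement i j hij
      refine left_ne_zero_of_mul (b := bourdon S.apex (S.endpoint k) (S.endpoint l)) ?_
      rw [hprod hij hik hil hjk hjl hkl]
      exact (div_pos (mul_pos (hpos _ _ hij) (hpos _ _ hkl)) hC).ne'
    intro u v huv
    by_contra hne'
    refine hne _ _ (w.symm.injective.ne hne') ?_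
    simp only at huv
    rw [huv, S.bourdon_self]
  · intro u₁ u₂ u₃ u₄ h12 h13 h14 h23 h24 h34
    have hi := fun {u v : W} (h : u ≠ v) => w.symm.injective.ne h
    simp only [crossRatio]
    rw [hprod (hi h12) (hi h13) (hi h14) (hi h23) (hi h24) (hi h34),
      hprod (hi h13) (hi h12) (hi h14) (hi h23.symm) (hi h34) (hi h24),
      div_div_div_cancel_right₀ hC.ne']
    simp only [Equiv.apply_symm_apply]
  · simp only [Equiv.symm_apply_apply]
    exact ⟨h01, h23, h12, h30, h02, h13, hα, hα', hαa, hβ, hβ', hβb, by linarith, S.ray,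
      S.isRayTo_ray, hSα ▸ S.isCyclicGluing⟩
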